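/- Let $L\subset\mathbb{R}^n$ be a bimodular lattice of rank $n$: a subgroup of Euclidean $\mathbb{R}^n$ isomorphic to $\mathbb{Z}^n$ such that $v\cdot w\in\mathbb{Z}$ for all $v,w\in L$, and such that the Gram matrix of a $\mathbb{Z}$-basis of $L$ has determinant $2$. Let $L'=\{\xi\in\mathbb{R}^n : \xi\cdot v\in\mathbb{Z}\text{ for all }v\in L\}$ be its dual, let $$\mathrm{Char}(L)=\{\xi\in L' : \xi\cdot v\equiv v\cdot v \pmod 2\text{ for all }v\in L\}$$ be its set of characteristic covectors, and write $\xi^2=\xi\cdot\xi$. Put $\mathrm{Char}_\pm(L)=\{\xi\in\mathrm{Char}(L) : \xi^2\equiv n\pm1 \pmod 8\}$. Then $\mathrm{Char}(L)$ is the disjoint union of $\mathrm{Char}_+(L)$ and $\mathrm{Char}_-(L)$, and the minima $$d_\pm(L)=\min_{\xi\in\mathrm{Char}_\pm(L)}\frac{\xi^2-n}{4}$$ exist (both classes are non-empty and the minima are attained). Moreover $$d_+(L)+d_-(L)\le 0,$$ and if equality holds, then $L$ is isometric to the diagonal lattice $I^{n-1}\oplus A_1$, where $I^{n-1}$ is $\mathbb{Z}^{n-1}$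 with the standard inner product and $A_1$ is the rank-one lattice generated by a vector of square $2$; in particular $d_+(L)=\tfrac14$ and $d_-(L)=-\tfrac14$. -/

import Mathlib

open scoped RealInnerProductSpace

noncomputable section

/-- The dual lattice: the vectors of the ambient space that pair integrally with every element
of `Λ`. -/
def dualLattice {E : Type*} [NormedAddCommGroup E] [InnerProductSpace ℝ E]
    (Λ : Submodule ℤ E) : Submodule ℤ E :=
  LinearMap.BilinForm.dualSubmodule (innerₗ E) Λ

/-- Characteristic covectors: elements `ξ` of the dual lattice with `⟨ξ, v⟩ ≡ v² (mod 2)` for all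
`v ∈ Λ`. -/
def charCovectors {E : Type*} [NormedAddCommGroup E] [InnerProductSpace ℝ E]
    (Λ : Submodule ℤ E) : Set E :=
  {ξ | ξ ∈ dualLattice Λ ∧ ∀ v ∈ Λ, ∃ k : ℤ, ⟪ξ, v⟫ - ⟪v, v⟫ = 2 * (k : ℝ)}

/-- A bimodular lattice of rank `n`: a subgroup `L` of Euclidean `ℝⁿ` that is free of rank `n`,
with integral inner products and with determinant (of the Gram matrix of a `ℤ`-basis) `2`.
The existence of a basis with nonzero Gram determinant forces `L` to be discrete and to span `ℝⁿ`;
the value of the determinant does not depend on the basis. -/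
structure IsBimodular {n : ℕ} (L : Submodule ℤ (EuclideanSpace ℝ (Fin n))) : Prop where
  integral : ∀ v ∈ L, ∀ w ∈ L, ∃ k : ℤ, ⟪v, w⟫ = (k : ℝ)
  det_eq_two : ∃ b : Module.Basis (Fin n) ℤ L,
    (Matrix.gram ℝ (fun i => (b i : EuclideanSpace ℝ (Fin n)))).det = 2

/-- For a sign `s = ±1`, the characteristic covectors `ξ` with `ξ² ≡ n + s (mod 8)`. -/
def charCovectorsSign {n : ℕ} (s : ℤˣ) (L : Submodule ℤ (EuclideanSpace ℝ (Fin n))) :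
    Set (EuclideanSpace ℝ (Fin n)) :=
  {ξ | ξ ∈ charCovectors L ∧ ∃ k : ℤ, ⟪ξ, ξ⟫ - ((n : ℝ) + ((s : ℤ) : ℝ)) = 8 * (k : ℝ)}

/-- The numbers `(ξ² - n) / 4`, for `ξ` in the class of characteristic covectors of sign `s`. -/
def defectValues {n : ℕ} (s : ℤˣ) (L : Submodule ℤ (EuclideanSpace ℝ (Fin n))) : Set ℝ :=
  (fun ξ => (⟪ξ, ξ⟫ - (n : ℝ)) / 4) '' charCovectorsSign s L

/-- The defect `d_s(L)`, `s = ±1`: the minimum of `(ξ² - n) / 4` over the class of sign `s`. It is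
defined as an infimum; that it is attained is part of the theorem. -/
def defect {n : ℕ} (s : ℤˣ) (L : Submodule ℤ (EuclideanSpace ℝ (Fin n))) : ℝ :=
  sInf (defectValues s L)

/-- The lattice `I^m`, generated by the standard orthonormal basis of `ℝ^m`. -/
def latticeI (m : ℕ) : Submodule ℤ (EuclideanSpace ℝ (Fin m)) :=
  Submodule.span ℤ (Set.range (EuclideanSpace.basisFun (Fin m) ℝ))

/-- The root lattice `A₁`, generated in `ℝ` by a vector of square `2`. -/
def latticeA1 : Submodule ℤ ℝ :=
  Submodule.span ℤ {√2}

/-- The orthogonal direct sum of two lattices, in the orthogonal sum of the ambient spaces. -/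
def orthogonalSum {E F : Type*} [NormedAddCommGroup E] [InnerProductSpace ℝ E]
    [NormedAddCommGroup F] [InnerProductSpace ℝ F]
    (Λ₁ : Submodule ℤ E) (Λ₂ : Submodule ℤ F) : Submodule ℤ (WithLp 2 (E × F)) :=
  (Λ₁.prod Λ₂).map (WithLp.linearEquiv 2 ℤ (E × F)).symm.toLinearMap

/-- Isomorphism of lattices: a group isomorphism preserving the inner product. -/
def LatticeIsometric {E F : Type*} [NormedAddCommGroup E] [InnerProductSpace ℝ E]
    [NormedAddCommGroup F] [InnerProductSpace ℝ F]
    (Λ₁ : Submodule ℤ E) (Λ₂ : Submodule ℤ F) : Prop :=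
  ∃ e : Λ₁ ≃ₗ[ℤ] Λ₂, ∀ v w : Λ₁, ⟪(e v : F), (e w : F)⟫ = ⟪(v : E), (w : E)⟫

end

/-!
An integral lattice `L` of determinant `2` has a dual of the form `L ∪ (g + L)`, and here `⟪g, g⟫`
is a half-integer. Gluing along `g` embeds `L ⊕ M`, for another such lattice `M`, with index two in
a unimodular lattice; this is applied to `M = A₁` and to `M = L`.

Characteristic vectors of a unimodular lattice of rank `N` have square `≡ N (mod 8)` (van der Blij's
lemma, by Poisson summation for theta series). In the gluing of `L` with `A₁` this splits the
characteristic covectors of `L` into the two classes; in the double of `L` it forces the two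
components of a characteristic vector to lie in opposite classes. By Elkies' theorem a unimodular
lattice of rank `N` has a characteristic vector of square at most `N`, and if it has none of smaller
square it is `ℤ^N`: subtract from each of its theta series `θ₂`, `θ₃`, `θ₄` that of `ℤ^N`; the
eighth power of the product of the three differences is a level-one modular form of weight `12N`
vanishing to order greater than `N` at the cusp, hence zero, so the lattice has as many unit vectors
as `ℤ^N`.

For the double of `L`, where `N = 2n`, the inequality says `d₊ + d₋ ≤ 0`, and equality makes the
double `ℤ^(2n)`. Each of its unit vectors lies in one of the two summands or has two components of
square `1 / 2`; hence `ℝ^n` has an orthonormal basis all but one of whose vectors lie in `L`, as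
does `√2` times the last one.
-/

noncomputable section

open Complex MeasureTheory Module TopologicalSpace UnitAddTorus
open scoped FourierTransform Pointwise

/-! ### Poisson summation -/

section Poisson

variable {ι : Type*}

lemma exists_continuousMap_unitAddTorus {Y : Type*} [TopologicalSpace Y] (g : C(ι → ℝ, Y))
    (hg : ∀ (k : ι → ℤ) x, g (x + Int.cast ∘ k) = g x) :
    ∃ G : C(UnitAddTorus ι, Y), ∀ x : ι → ℝ, G (fun i ↦ (x i : UnitAddCircle)) = g x := by
  let π : C(ι → ℝ, UnitAddTorus ι) :=
    ⟨Pi.map fun _ x ↦ (x : UnitAddCircle),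
      .piMap fun _ ↦ QuotientAddGroup.isOpenQuotientMap_mk.continuous⟩
  have hπ : IsOpenQuotientMap π :=
    .piMap fun _ ↦ QuotientAddGroup.isOpenQuotientMap_mk
  have hfactors : Function.FactorsThrough g π := by
    intro x y hxy
    have hint (i : ι) : ∃ k : ℤ, y i + k = x i := by
      obtain ⟨k, hk⟩ := AddSubgroup.mem_zmultiples_iff.1
        (QuotientAddGroup.eq.1 (congrFun hxy i).symm)
      exact ⟨k, by simp only [zsmul_one] at hk; rw [hk, add_neg_cancel_left]⟩
    choose k hk using hint
    rw [← hg k y, ← funext hk]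
    rfl
  exact ⟨hπ.isQuotientMap.lift g hfactors,
    fun x ↦ DFunLike.congr_fun (hπ.isQuotientMap.lift_comp g hfactors) x⟩

lemma tsum_comp_add_int_periodic {E : Type*} [NormedAddCommGroup E] (f : (ι → ℝ) → E)
    (k : ι → ℤ) (x : ι → ℝ) :
    ∑' l : ι → ℤ, f (x + Int.cast ∘ k + Int.cast ∘ l) =
      ∑' l : ι → ℤ, f (x + Int.cast ∘ l) := by
  rw [← (Equiv.addLeft k).tsum_eq fun l : ι → ℤ ↦ f (x + Int.cast ∘ l)]
  refine tsum_congr fun l ↦ congrArg f ?_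
  ext i
  simp [add_assoc]

/-- The half-open unit cube in `ℝ^ι`, a fundamental domain for the action of `ℤ^ι`. -/
def unitCube (ι : Type*) : Set (ι → ℝ) :=
  {x | ∀ i, x i ∈ Set.Ioc 0 1}

lemma unitCube_subset_Icc : unitCube ι ⊆ Set.Icc 0 1 :=
  fun _ hx ↦ ⟨fun i ↦ (hx i).1.le, fun i ↦ (hx i).2⟩

lemma measurableSet_unitCube [Countable ι] : MeasurableSet (unitCube ι) :=
  MeasurableSet.univ_pi' fun _ ↦ measurableSet_Ioc

variable [Fintype ι]

lemma mFourier_coe_apply (k : ι → ℤ) (x : ι → ℝ) :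
    mFourier k (fun i ↦ (x i : UnitAddCircle)) =
      cexp (2 * Real.pi * I * ∑ i, (k i : ℂ) * x i) := by
  simp only [mFourier, ContinuousMap.coe_mk, fourier_coe_apply, Finset.mul_sum, Complex.exp_sum]
  refine Finset.prod_congr rfl fun i _ ↦ ?_
  rw [ofReal_one, div_one, mul_assoc, mul_assoc]

lemma norm_mFourier_apply (k : ι → ℤ) (t : UnitAddTorus ι) : ‖mFourier k t‖ = 1 := by
  simp only [mFourier, ContinuousMap.coe_mk, fourier_apply, norm_prod, Circle.norm_coe,
    Finset.prod_const_one]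

section Periodization

variable {E : Type*} [NormedAddCommGroup E] {f : C(ι → ℝ, E)}

lemma integrable_of_summable_norm_restrict_Icc
    (hf : Summable fun k : ι → ℤ ↦
      ‖(f.comp (.addRight (Int.cast ∘ k))).restrict (Set.Icc (0 : ι → ℝ) 1)‖) :
    Integrable f := by
  let cube (k : ι → ℤ) : Compacts (ι → ℝ) :=
    ⟨Set.Icc (Int.cast ∘ k) (Int.cast ∘ k + 1), isCompact_Icc⟩
  refine integrable_of_summable_norm_restrict (s := cube)
    (.of_nonneg_of_le (fun k ↦ by positivity) (fun k ↦ ?_) hf) ?_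
  · have hvol : volume.real (cube k : Set (ι → ℝ)) = 1 := by
      simp [cube, measureReal_def, Real.volume_Icc_pi]
    rw [hvol, mul_one, ContinuousMap.norm_le _ (norm_nonneg _)]
    rintro ⟨x, hx⟩
    have hmem : x - Int.cast ∘ k ∈ Set.Icc (0 : ι → ℝ) 1 :=
      ⟨sub_nonneg.2 hx.1, sub_le_iff_le_add'.2 hx.2⟩
    have hle := ((f.comp (.addRight (Int.cast ∘ k))).restrict
      (Set.Icc (0 : ι → ℝ) 1)).norm_coe_le_norm ⟨_, hmem⟩
    simpa only [ContinuousMap.restrict_apply, ContinuousMap.comp_apply,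
      ContinuousMap.coe_addRight, sub_add_cancel] using hle
  · refine Set.eq_univ_of_forall fun x ↦ Set.mem_iUnion.2 ⟨fun i ↦ ⌊x i⌋, ?_⟩
    exact ⟨fun i ↦ Int.floor_le _, fun i ↦ (Int.lt_floor_add_one _).le⟩

variable [NormedSpace ℝ E]

lemma integral_eq_tsum_setIntegral_unitCube {f : (ι → ℝ) → E} (hf : Integrable f) :
    ∫ x, f x = ∑' k : ι → ℤ, ∫ x in unitCube ι, f (x + Int.cast ∘ k) := by
  let cube (k : ι → ℤ) : Set (ι → ℝ) := {x | x - Int.cast ∘ k ∈ unitCube ι}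
  have mem_cube (k : ι → ℤ) (x : ι → ℝ) : x ∈ cube k ↔ ∀ i, ⌈x i⌉ - 1 = k i := by
    refine forall_congr' fun i ↦ ?_
    rw [sub_eq_iff_eq_add, Int.ceil_eq_iff, Pi.sub_apply, Function.comp_apply, Set.mem_Ioc]
    push_cast
    constructor <;> rintro ⟨h₁, h₂⟩ <;> constructor <;> linarith
  have measurable_cube (k : ι → ℤ) : MeasurableSet (cube k) :=
    measurable_id.sub_const _ measurableSet_unitCube
  have disjoint_cube : Pairwise (Function.onFun Disjoint cube) := fun k l hkl ↦
    Set.disjoint_left.2 fun x hk hl ↦ hkl <| funext fun i ↦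
      ((mem_cube k x).1 hk i).symm.trans ((mem_cube l x).1 hl i)
  have iUnion_cube : ⋃ k, cube k = Set.univ := Set.eq_univ_of_forall fun x ↦
    Set.mem_iUnion.2 ⟨fun i ↦ ⌈x i⌉ - 1, (mem_cube _ x).2 fun i ↦ rfl⟩
  have hsum := hasSum_integral_iUnion measurable_cube disjoint_cube hf.integrableOn
  rw [iUnion_cube, setIntegral_univ] at hsum
  rw [← hsum.tsum_eq]
  refine tsum_congr fun k ↦ ?_
  rw [← (measurePreserving_add_right volume (Int.cast ∘ k : ι → ℝ)).setIntegral_preimage_emb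
    (measurableEmbedding_addRight _)]
  congr 2
  ext x
  simp [cube]

lemma integral_eq_setIntegral_unitCube_tsum
    (hf : Summable fun k : ι → ℤ ↦
      ‖(f.comp (.addRight (Int.cast ∘ k))).restrict (Set.Icc (0 : ι → ℝ) 1)‖) :
    ∫ x, f x = ∫ x in unitCube ι, ∑' k : ι → ℤ, f (x + Int.cast ∘ k) := by
  rw [integral_eq_tsum_setIntegral_unitCube (integrable_of_summable_norm_restrict_Icc hf)]
  have hterm (k : ι → ℤ) : IntegrableOn (fun x ↦ f (x + Int.cast ∘ k)) (unitCube ι) :=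
    ((f.comp (.addRight (Int.cast ∘ k))).continuous.integrableOn_Icc).mono_set
      unitCube_subset_Icc
  refine (hasSum_integral_of_summable_integral_norm hterm
    (.of_norm_bounded (hf.mul_right (volume.real (unitCube ι))) fun k ↦ ?_)).tsum_eq
  refine norm_setIntegral_le_of_norm_le_const
    ((measure_mono unitCube_subset_Icc).trans_lt isCompact_Icc.measure_lt_top) fun x hx ↦ ?_
  rw [norm_norm]
  exact ((f.comp (.addRight (Int.cast ∘ k))).restrict
    (Set.Icc (0 : ι → ℝ) 1)).norm_coe_le_norm ⟨x, unitCube_subset_Icc hx⟩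

end Periodization

lemma mFourierCoeff_of_eq_tsum {f : C(ι → ℝ, ℂ)}
    (hf : Summable fun k : ι → ℤ ↦
      ‖(f.comp (.addRight (Int.cast ∘ k))).restrict (Set.Icc (0 : ι → ℝ) 1)‖)
    {F : UnitAddTorus ι → ℂ}
    (hF : ∀ x : ι → ℝ, F (fun i ↦ (x i : UnitAddCircle)) = ∑' k : ι → ℤ, f (x + Int.cast ∘ k))
    (m : ι → ℤ) :
    mFourierCoeff F m =
      ∫ x : ι → ℝ, mFourier (-m) (fun i ↦ (x i : UnitAddCircle)) * f x := by
  let χ : C(ι → ℝ, ℂ) :=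
    (mFourier (-m)).comp ⟨fun x i ↦ (x i : UnitAddCircle), continuous_pi fun i ↦
      (AddCircle.continuous_mk' 1).comp (continuous_apply i)⟩
  have hχ (x : ι → ℝ) : ‖χ x‖ = 1 := norm_mFourier_apply _ _
  have hχ_add (x : ι → ℝ) (k : ι → ℤ) : χ (x + Int.cast ∘ k) = χ x := by
    simp [χ]
  have hmul : Summable fun k : ι → ℤ ↦
      ‖((χ * f).comp (.addRight (Int.cast ∘ k))).restrict (Set.Icc (0 : ι → ℝ) 1)‖ := by
    simpa [ContinuousMap.norm_eq_iSup_norm, hχ] using hf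
  calc mFourierCoeff F m
      = ∫ x in unitCube ι, χ x * ∑' k : ι → ℤ, f (x + Int.cast ∘ k) := by
        simp only [mFourierCoeff_eq_integral _ _ 0, Pi.zero_apply, zero_add, hF, smul_eq_mul,
          unitCube, χ, ContinuousMap.comp_apply, ContinuousMap.coe_mk]
    _ = ∫ x in unitCube ι, ∑' k : ι → ℤ, (χ * f) (x + Int.cast ∘ k) := by
        simp only [ContinuousMap.mul_apply, hχ_add, tsum_mul_left]
    _ = ∫ x : ι → ℝ, χ x * f x := (integral_eq_setIntegral_unitCube_tsum hmul).symm

theorem tsum_comp_add_int_eq_tsum_integral_mFourier {f : C(ι → ℝ, ℂ)}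
    (hf : ∀ K : Compacts (ι → ℝ), Summable fun k : ι → ℤ ↦
      ‖(f.comp (.addRight (Int.cast ∘ k))).restrict K‖)
    (hsum : Summable fun k : ι → ℤ ↦
      ∫ x : ι → ℝ, mFourier (-k) (fun i ↦ (x i : UnitAddCircle)) * f x) (x : ι → ℝ) :
    ∑' k : ι → ℤ, f (x + Int.cast ∘ k) =
      ∑' k : ι → ℤ, (∫ y : ι → ℝ, mFourier (-k) (fun i ↦ (y i : UnitAddCircle)) * f y) *
        mFourier k (fun i ↦ (x i : UnitAddCircle)) := by
  have hperiod (y : ι → ℝ) : (∑' k : ι → ℤ, f.comp (.addRight (Int.cast ∘ k))) y =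
      ∑' k : ι → ℤ, f (y + Int.cast ∘ k) :=
    (ContinuousMap.tsum_apply (ContinuousMap.summable_of_locally_summable_norm hf) y).symm
  obtain ⟨F, hF⟩ := exists_continuousMap_unitAddTorus
    (∑' k : ι → ℤ, f.comp (.addRight (Int.cast ∘ k))) fun k y ↦ by
      rw [hperiod, hperiod, tsum_comp_add_int_periodic]
  simp only [hperiod] at hF
  have hcoeff := mFourierCoeff_of_eq_tsum (hf ⟨Set.Icc 0 1, isCompact_Icc⟩) hF
  have hseries := hasSum_mFourier_series_apply_of_summable (f := F)
    (hsum.congr fun k ↦ (hcoeff k).symm) fun i ↦ (x i : UnitAddCircle)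
  simp only [← hF, ← hseries.tsum_eq, hcoeff, smul_eq_mul]

end Poisson

lemma norm_restrict_comp_le {X Y : Type*} [TopologicalSpace X] [TopologicalSpace Y] (f : C(Y, ℂ))
    (T : C(X, Y)) (K : Compacts X) :
    ‖(f.comp T).restrict K‖ ≤ ‖f.restrict (K.map T T.continuous)‖ :=
  (ContinuousMap.norm_le _ (norm_nonneg _)).2 fun x ↦
    (f.restrict (K.map T T.continuous)).norm_coe_le_norm ⟨T x, Set.mem_image_of_mem T x.2⟩

section LatticePoisson

variable {E : Type*} [NormedAddCommGroup E] [InnerProductSpace ℝ E]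

lemma mem_dualLattice {Λ : Submodule ℤ E} {ξ : E} :
    ξ ∈ dualLattice Λ ↔ ∀ v ∈ Λ, ∃ k : ℤ, ⟪ξ, v⟫ = (k : ℝ) := by
  simp [dualLattice, LinearMap.BilinForm.mem_dualSubmodule, Submodule.mem_one, eq_comm]

variable (E) in
lemma innerₗ_nondegenerate : LinearMap.BilinForm.Nondegenerate (innerₗ E) :=
  ⟨fun x hx ↦ inner_self_eq_zero.1 (hx x), fun x hx ↦ inner_self_eq_zero.1 (hx x)⟩

variable {ι : Type*}

lemma exists_linearEquiv_dualLattice_span [Fintype ι] (b : Basis ι ℝ E) :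
    ∃ e : (ι → ℤ) ≃ₗ[ℤ] dualLattice (Submodule.span ℤ (Set.range b)),
      ∀ (k : ι → ℤ) (x : ι → ℝ), ⟪(e k : E), b.equivFun.symm x⟫ = ∑ i, k i * x i := by
  classical
  let b' := LinearMap.BilinForm.dualBasis (innerₗ E) (innerₗ_nondegenerate E) b
  let e : (ι → ℤ) ≃ₗ[ℤ] dualLattice (Submodule.span ℤ (Set.range b)) :=
    (b'.restrictScalars ℤ).equivFun.symm.trans (LinearEquiv.ofEq _ _
      (LinearMap.BilinForm.dualSubmodule_span_of_basis (R := ℤ) _ (innerₗ_nondegenerate E) b).symm)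
  refine ⟨e, fun k x ↦ ?_⟩
  have he : (e k : E) = ∑ i, (k i : ℝ) • b' i := by
    change ((b'.restrictScalars ℤ).equivFun.symm k : E) = _
    simp [Basis.equivFun_symm_apply, Int.cast_smul_eq_zsmul]
  have hdual (i j : ι) : ⟪b' i, b j⟫ = if j = i then 1 else 0 :=
    LinearMap.BilinForm.apply_dualBasis_left (innerₗ_nondegenerate E) b i j
  simp [he, Basis.equivFun_symm_apply, sum_inner, inner_sum, inner_smul_left, inner_smul_right,
    hdual, mul_comm]

variable [FiniteDimensional ℝ E] [MeasurableSpace E] [BorelSpace E] (Λ : Submodule ℤ E)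
  [DiscreteTopology Λ] [IsZLattice ℝ Λ]

lemma map_equivFunL_symm_ofZLatticeBasis [Fintype ι] (b : Basis ι ℤ Λ) :
    Measure.map (b.ofZLatticeBasis ℝ Λ).equivFunL.symm volume =
      (ENNReal.ofReal (ZLattice.covolume Λ))⁻¹ • volume := by
  ext s hs
  rw [Measure.map_apply (ContinuousLinearEquiv.continuous _).measurable hs, Measure.smul_apply,
    smul_eq_mul, mul_comm, ← div_eq_mul_inv,
    ← ZLattice.volume_image_eq_volume_div_covolume' Λ b hs.nullMeasurableSet]
  exact congrArg volume ((b.ofZLatticeBasis ℝ Λ).equivFun.toEquiv.image_eq_preimage_symm s).symm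

lemma integral_comp_equivFunL_symm_ofZLatticeBasis [Fintype ι] (b : Basis ι ℤ Λ) (f : E → ℂ) :
    ∫ x, f ((b.ofZLatticeBasis ℝ Λ).equivFunL.symm x) =
      (ZLattice.covolume Λ : ℂ)⁻¹ * ∫ v, f v := by
  have hmap := (b.ofZLatticeBasis ℝ Λ).equivFunL.symm.toHomeomorph.measurableEmbedding.integral_map
    (μ := volume) f
  rw [ContinuousLinearEquiv.coe_toHomeomorph] at hmap
  rw [← hmap, map_equivFunL_symm_ofZLatticeBasis, integral_smul_measure, ENNReal.toReal_inv,
    ENNReal.toReal_ofReal (ZLattice.covolume_pos Λ volume).le, real_smul, ofReal_inv]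

omit [MeasurableSpace E] [BorelSpace E] in
lemma equivFunL_symm_ofZLatticeBasis_intCast [Finite ι] (b : Basis ι ℤ Λ) (k : ι → ℤ) :
    (b.ofZLatticeBasis ℝ Λ).equivFunL.symm (Int.cast ∘ k) = (b.equivFun.symm k : E) := by
  have := Fintype.ofFinite ι
  change (b.ofZLatticeBasis ℝ Λ).equivFun.symm (Int.cast ∘ k) = _
  simp [Basis.equivFun_symm_apply, Int.cast_smul_eq_zsmul]

omit [MeasurableSpace E] [BorelSpace E] in
lemma summable_norm_restrict_comp_of_lattice [Finite ι] (b : Basis ι ℤ Λ) {f : C(E, ℂ)}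
    (hf : ∀ K : Compacts E, Summable fun v : Λ ↦ ‖(f.comp (.addRight (v : E))).restrict K‖)
    (K : Compacts (ι → ℝ)) :
    Summable fun k : ι → ℤ ↦
      ‖((f.comp ((b.ofZLatticeBasis ℝ Λ).equivFunL.symm : C(ι → ℝ, E))).comp
        (.addRight (Int.cast ∘ k))).restrict K‖ := by
  let T : C(ι → ℝ, E) := (b.ofZLatticeBasis ℝ Λ).equivFunL.symm
  refine ((b.equivFun.symm.toEquiv.summable_iff).2 (hf (K.map T T.continuous))).of_nonneg_of_le
    (fun k ↦ norm_nonneg _) fun k ↦ ?_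
  have hcomp : (f.comp T).comp (.addRight (Int.cast ∘ k)) =
      (f.comp (.addRight (b.equivFun.symm k : E))).comp T :=
    ContinuousMap.ext fun x ↦ congrArg f ((map_add (b.ofZLatticeBasis ℝ Λ).equivFunL.symm _ _).trans
      (congrArg _ (equivFunL_symm_ofZLatticeBasis_intCast Λ b k)))
  rw [hcomp]
  exact norm_restrict_comp_le _ T K

theorem tsum_zlattice_eq_tsum_fourier {f : C(E, ℂ)}
    (hf : ∀ K : Compacts E, Summable fun v : Λ ↦ ‖(f.comp (.addRight (v : E))).restrict K‖)
    (hsum : Summable fun ξ : dualLattice Λ ↦ 𝓕 (f : E → ℂ) ξ) (z : E) :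
    ∑' v : Λ, f (z + v) = (ZLattice.covolume Λ : ℂ)⁻¹ *
      ∑' ξ : dualLattice Λ, 𝓕 (f : E → ℂ) ξ * cexp (2 * Real.pi * I * ⟪(ξ : E), z⟫) := by
  let b := Free.chooseBasis ℤ Λ
  let T := (b.ofZLatticeBasis ℝ Λ).equivFunL.symm
  obtain ⟨e, he⟩ : ∃ e : (Free.ChooseBasisIndex ℤ Λ → ℤ) ≃ₗ[ℤ] dualLattice Λ,
      ∀ k x, ⟪(e k : E), T x⟫ = ∑ i, k i * x i := by
    have h := exists_linearEquiv_dualLattice_span (b.ofZLatticeBasis ℝ Λ)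
    rwa [b.ofZLatticeBasis_span ℝ] at h
  have hchar (k : Free.ChooseBasisIndex ℤ Λ → ℤ) (x : Free.ChooseBasisIndex ℤ Λ → ℝ) :
      mFourier k (fun i ↦ (x i : UnitAddCircle)) = cexp (2 * Real.pi * I * ⟪(e k : E), T x⟫) := by
    rw [mFourier_coe_apply, he]
    push_cast
    rfl
  have hcoeff (k : Free.ChooseBasisIndex ℤ Λ → ℤ) :
      ∫ x : Free.ChooseBasisIndex ℤ Λ → ℝ,
        mFourier (-k) (fun i ↦ (x i : UnitAddCircle)) * f (T x) =
      (ZLattice.covolume Λ : ℂ)⁻¹ * 𝓕 (f : E → ℂ) (e k) := by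
    simp only [hchar]
    rw [Real.fourier_eq', integral_comp_equivFunL_symm_ofZLatticeBasis Λ b fun v ↦
      cexp (2 * Real.pi * I * ⟪(e (-k) : E), v⟫) * f v]
    congr 2 with v
    rw [map_neg, Submodule.coe_neg, inner_neg_left, real_inner_comm, smul_eq_mul]
    push_cast
    ring_nf
  have hpoisson := tsum_comp_add_int_eq_tsum_integral_mFourier
    (summable_norm_restrict_comp_of_lattice Λ b hf)
    (((e.toEquiv.summable_iff.2 hsum).mul_left _).congr fun k ↦ (hcoeff k).symm) (T.symm z)
  rw [← e.toEquiv.tsum_eq, ← b.equivFun.symm.toEquiv.tsum_eq, ← tsum_mul_left]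
  refine Eq.trans (tsum_congr fun k ↦ ?_) (hpoisson.trans (tsum_congr fun k ↦ ?_))
  · refine congrArg f (Eq.symm ((map_add T _ _).trans ?_))
    exact congrArg₂ _ (T.apply_symm_apply z) (equivFunL_symm_ofZLatticeBasis_intCast Λ b k)
  · refine (congrArg (· * _) (hcoeff k)).trans ?_
    simp [hchar, T, mul_assoc]

end LatticePoisson

/-! ### Theta series -/

section Decay

/-- A function on the upper half plane decays at rate `μ` if it is `O(|q| ^ μ)` at the cusp, where
`q = exp (π i τ)`. -/
def DecaysAtRate (μ : ℝ) (h : ℂ → ℂ) : Prop :=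
  ∃ C : ℝ, 0 ≤ C ∧ ∀ τ : ℂ, 1 ≤ τ.im → ‖h τ‖ ≤ C * Real.exp (-(Real.pi * μ) * τ.im)

namespace DecaysAtRate

variable {μ ν : ℝ} {g h : ℂ → ℂ}

lemma mono (hh : DecaysAtRate μ h) (hν : ν ≤ μ) : DecaysAtRate ν h := by
  obtain ⟨C, hC, hb⟩ := hh
  refine ⟨C, hC, fun τ hτ ↦ (hb τ hτ).trans ?_⟩
  gcongr

lemma sub (hg : DecaysAtRate μ g) (hh : DecaysAtRate μ h) : DecaysAtRate μ (g - h) := by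
  obtain ⟨C, hC, hbC⟩ := hg
  obtain ⟨D, hD, hbD⟩ := hh
  refine ⟨C + D, add_nonneg hC hD, fun τ hτ ↦ ?_⟩
  rw [add_mul]
  exact (norm_sub_le _ _).trans (add_le_add (hbC τ hτ) (hbD τ hτ))

lemma mul (hg : DecaysAtRate μ g) (hh : DecaysAtRate ν h) : DecaysAtRate (μ + ν) (g * h) := by
  obtain ⟨C, hC, hbC⟩ := hg
  obtain ⟨D, hD, hbD⟩ := hh
  refine ⟨C * D, mul_nonneg hC hD, fun τ hτ ↦ ?_⟩
  calc ‖(g * h) τ‖ = ‖g τ‖ * ‖h τ‖ := norm_mul _ _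
    _ ≤ (C * Real.exp (-(Real.pi * μ) * τ.im)) * (D * Real.exp (-(Real.pi * ν) * τ.im)) := by
      gcongr
      exacts [hbC τ hτ, hbD τ hτ]
    _ = C * D * Real.exp (-(Real.pi * (μ + ν)) * τ.im) := by
      rw [mul_mul_mul_comm, ← Real.exp_add]
      ring_nf

lemma pow (hh : DecaysAtRate μ h) (k : ℕ) : DecaysAtRate (k * μ) (h ^ k) := by
  obtain ⟨C, hC, hb⟩ := hh
  refine ⟨C ^ k, by positivity, fun τ hτ ↦ ?_⟩
  calc ‖(h ^ k) τ‖ = ‖h τ‖ ^ k := norm_pow _ _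
    _ ≤ (C * Real.exp (-(Real.pi * μ) * τ.im)) ^ k := by gcongr; exact hb τ hτ
    _ = C ^ k * Real.exp (-(Real.pi * (k * μ)) * τ.im) := by
      rw [mul_pow, ← Real.exp_nat_mul]
      ring_nf

lemma comp_add_one (hh : DecaysAtRate μ h) : DecaysAtRate μ fun τ ↦ h (τ + 1) := by
  obtain ⟨C, hC, hb⟩ := hh
  exact ⟨C, hC, fun τ hτ ↦ by simpa using hb (τ + 1) (by simpa using hτ)⟩

end DecaysAtRate

end Decay

section ThetaSeries

variable {E : Type*} [NormedAddCommGroup E]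

/-- The theta series of the translate `U + z` of a lattice, with coefficients `c`: the general term
is `c v * q ^ (‖v + z‖ ^ 2)` with `q = exp (π i τ)`. -/
def thetaSeries (U : Submodule ℤ E) (c : U → ℂ) (z : E) (τ : ℂ) : ℂ :=
  ∑' v : U, c v * cexp (Real.pi * I * τ * (‖(v : E) + z‖ ^ 2 : ℝ))

lemma norm_cexp_pi_mul_I_mul_ofReal (τ : ℂ) (r : ℝ) :
    ‖cexp (Real.pi * I * τ * r)‖ = Real.exp (-(Real.pi * τ.im) * r) := by
  rw [Complex.norm_exp]
  congr 1
  simp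

lemma norm_thetaSeries_term_le {U : Submodule ℤ E} {c : U → ℂ} (hc : ∀ v, ‖c v‖ ≤ 1) (z : E)
    (τ : ℂ) (v : U) :
    ‖c v * cexp (Real.pi * I * τ * (‖(v : E) + z‖ ^ 2 : ℝ))‖ ≤
      Real.exp (-(Real.pi * τ.im) * ‖(v : E) + z‖ ^ 2) := by
  rw [norm_mul, norm_cexp_pi_mul_I_mul_ofReal]
  exact mul_le_of_le_one_left (Real.exp_nonneg _) (hc v)

lemma exp_neg_mul_sq_le {a t : ℝ} (ha : 0 < a) (ht : 0 < t) (N : ℕ) :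
    Real.exp (-a * t ^ 2) ≤ N.factorial / a ^ N * t⁻¹ ^ (2 * N) := by
  have hpow := Real.pow_div_factorial_le_exp (a * t ^ 2) (by positivity) N
  calc Real.exp (-a * t ^ 2) = (Real.exp (a * t ^ 2))⁻¹ := by rw [neg_mul, Real.exp_neg]
    _ ≤ ((a * t ^ 2) ^ N / N.factorial)⁻¹ := inv_anti₀ (by positivity) hpow
    _ = _ := by
      rw [inv_div, mul_pow, ← pow_mul, inv_pow]
      field_simp

variable [NormedSpace ℝ E] [FiniteDimensional ℝ E] (U : Submodule ℤ E) [DiscreteTopology U]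

lemma summable_exp_neg_mul_norm_sq {a : ℝ} (ha : 0 < a) (z : E) :
    Summable fun v : U ↦ Real.exp (-a * ‖(v : E) + z‖ ^ 2) := by
  let N := finrank ℤ U + 1
  have hsum := ZLattice.summable_norm_sub_inv_pow U (2 * N) (by omega) (-z)
  refine .of_norm_bounded_eventually (hsum.mul_left (N.factorial / a ^ N)) ?_
  have hfin : {v : U | (v : E) + z = 0}.Finite :=
    Set.Subsingleton.finite fun v (hv : (v : E) + z = 0) w hw ↦
      Subtype.ext (add_right_cancel (hv.trans hw.symm))
  filter_upwards [hfin.compl_mem_cofinite] with v (hv : (v : E) + z ≠ 0)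
  rw [Real.norm_eq_abs, Real.abs_exp, sub_neg_eq_add]
  exact exp_neg_mul_sq_le ha (norm_pos_iff.2 hv) _

lemma thetaSeries_one_I_ne_zero (z : E) : thetaSeries U 1 z I ≠ 0 := by
  have hreal : thetaSeries U 1 z I =
      (∑' v : U, Real.exp (-Real.pi * ‖(v : E) + z‖ ^ 2) : ℝ) := by
    rw [thetaSeries, ofReal_tsum]
    refine tsum_congr fun v ↦ ?_
    rw [Pi.one_apply, one_mul, ofReal_exp, mul_assoc (Real.pi : ℂ), I_mul_I]
    push_cast
    ring_nf
  rw [hreal, ofReal_ne_zero]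
  exact ((summable_exp_neg_mul_norm_sq U Real.pi_pos z).tsum_pos (fun v ↦ Real.exp_nonneg _) 0
    (Real.exp_pos _)).ne'

variable {U} {c : U → ℂ} (hc : ∀ v, ‖c v‖ ≤ 1)

include hc

lemma summable_thetaSeries (z : E) {τ : ℂ} (hτ : 0 < τ.im) :
    Summable fun v : U ↦ c v * cexp (Real.pi * I * τ * (‖(v : E) + z‖ ^ 2 : ℝ)) :=
  .of_norm_bounded (summable_exp_neg_mul_norm_sq U (by positivity) z)
    (norm_thetaSeries_term_le hc z τ)

lemma differentiableOn_thetaSeries (z : E) :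
    DifferentiableOn ℂ (thetaSeries U c z) {τ | 0 < τ.im} := by
  intro τ₀ (hτ₀ : 0 < τ₀.im)
  have hopen : IsOpen {τ : ℂ | τ₀.im / 2 < τ.im} := isOpen_lt continuous_const continuous_im
  have hdiff : DifferentiableOn ℂ (thetaSeries U c z) {τ : ℂ | τ₀.im / 2 < τ.im} := by
    refine differentiableOn_tsum_of_summable_norm
      (summable_exp_neg_mul_norm_sq U (a := Real.pi * (τ₀.im / 2)) (by positivity) z)
      (fun v ↦ by fun_prop) hopen fun v τ (hτ : τ₀.im / 2 < τ.im) ↦ ?_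
    refine (norm_thetaSeries_term_le hc z τ v).trans ?_
    gcongr
  exact (hdiff.differentiableAt (hopen.mem_nhds (half_lt_self hτ₀))).differentiableWithinAt

lemma decaysAtRate_thetaSeries (z : E) {μ : ℝ} (hμ : ∀ v, c v ≠ 0 → μ ≤ ‖(v : E) + z‖ ^ 2) :
    DecaysAtRate μ (thetaSeries U c z) := by
  refine ⟨Real.exp (Real.pi * μ) * ∑' v : U, Real.exp (-Real.pi * ‖(v : E) + z‖ ^ 2),
    by positivity, fun τ hτ ↦ ?_⟩
  rw [mul_right_comm, ← Real.exp_add, ← tsum_mul_left]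
  refine tsum_of_norm_bounded
    ((summable_exp_neg_mul_norm_sq U Real.pi_pos z).mul_left _).hasSum fun v ↦ ?_
  by_cases hv : c v = 0
  · simp only [hv, zero_mul, norm_zero]
    positivity
  refine (norm_thetaSeries_term_le hc z τ v).trans ?_
  rw [← Real.exp_add, Real.exp_le_exp]
  nlinarith [mul_nonneg (mul_nonneg Real.pi_pos.le (sub_nonneg.2 hτ)) (sub_nonneg.2 (hμ v hv))]

end ThetaSeries

section Gaussian

variable {E : Type*} [NormedAddCommGroup E]

variable (E) in
/-- The Gaussian `exp (π i τ ‖v‖ ^ 2)`, whose sum over a lattice is a theta series. -/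
def gaussian (τ : ℂ) : C(E, ℂ) where
  toFun v := cexp (Real.pi * I * τ * (‖v‖ ^ 2 : ℝ))

lemma norm_gaussian (τ : ℂ) (v : E) :
    ‖gaussian E τ v‖ = Real.exp (-(Real.pi * τ.im) * ‖v‖ ^ 2) :=
  norm_cexp_pi_mul_I_mul_ofReal τ _

lemma thetaSeries_one_eq_tsum_gaussian (U : Submodule ℤ E) (z : E) (τ : ℂ) :
    thetaSeries U 1 z τ = ∑' v : U, gaussian E τ (z + v) := by
  simp [thetaSeries, gaussian, add_comm]

lemma norm_gaussian_add_le {τ : ℂ} (hτ : 0 < τ.im) (x v : E) :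
    ‖gaussian E τ (x + v)‖ ≤
      Real.exp (Real.pi * τ.im * ‖x‖ ^ 2) * Real.exp (-(Real.pi * τ.im / 2) * ‖v‖ ^ 2) := by
  have htri : ‖v‖ ^ 2 ≤ 2 * ‖x + v‖ ^ 2 + 2 * ‖x‖ ^ 2 := by
    have hle : ‖v‖ ≤ ‖x + v‖ + ‖x‖ := by simpa using norm_sub_le (x + v) x
    nlinarith [norm_nonneg v, sq_nonneg (‖x + v‖ - ‖x‖)]
  rw [norm_gaussian, ← Real.exp_add, Real.exp_le_exp]
  nlinarith [mul_pos Real.pi_pos hτ]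

lemma summable_norm_restrict_gaussian [NormedSpace ℝ E] [FiniteDimensional ℝ E]
    (U : Submodule ℤ E) [DiscreteTopology U] {τ : ℂ} (hτ : 0 < τ.im) (K : Compacts E) :
    Summable fun v : U ↦ ‖((gaussian E τ).comp (.addRight (v : E))).restrict K‖ := by
  obtain ⟨R, hR⟩ := K.isCompact.isBounded.exists_norm_le
  refine ((summable_exp_neg_mul_norm_sq U (a := Real.pi * τ.im / 2) (by positivity) 0).mul_left
    (Real.exp (Real.pi * τ.im * R ^ 2))).of_nonneg_of_le (fun v ↦ norm_nonneg _) fun v ↦ ?_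
  refine (ContinuousMap.norm_le _ (by positivity)).2 fun x ↦ ?_
  refine (norm_gaussian_add_le hτ (x : E) v).trans ?_
  rw [add_zero]
  gcongr
  exact hR x x.2

end Gaussian

section Inversion

/-- The factor of automorphy `(τ / i) ^ (-m / 2)` in the inversion formula for theta series. -/
def thetaFactor (m : ℕ) (τ : ℂ) : ℂ := (I / τ) ^ ((m : ℂ) / 2)

lemma thetaFactor_I (m : ℕ) : thetaFactor m I = 1 := by
  rw [thetaFactor, div_self I_ne_zero, one_cpow]

lemma thetaFactor_ne_zero (m : ℕ) {τ : ℂ} (hτ : τ ≠ 0) : thetaFactor m τ ≠ 0 := by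
  simp [thetaFactor, cpow_eq_zero_iff, hτ]

lemma thetaFactor_pow_eight (m : ℕ) {τ : ℂ} (hτ : τ ≠ 0) :
    thetaFactor m τ ^ 8 * τ ^ (4 * m) = 1 := by
  rw [thetaFactor, ← cpow_nat_mul,
    show ((8 : ℕ) : ℂ) * (m / 2) = ((4 * m : ℕ) : ℂ) by push_cast; ring, cpow_natCast, div_pow,
    pow_mul, I_pow_four, one_pow, one_div_mul_cancel (pow_ne_zero _ hτ)]

lemma ne_zero_of_im_pos {τ : ℂ} (hτ : 0 < τ.im) : τ ≠ 0 := by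
  rintro rfl
  simp at hτ

lemma im_neg_one_div_pos {τ : ℂ} (hτ : 0 < τ.im) : 0 < (-1 / τ).im := by
  have hτ0 := ne_zero_of_im_pos hτ
  rw [neg_div, one_div, neg_im, inv_im, neg_div, neg_neg]
  exact div_pos hτ (normSq_pos.2 hτ0)

variable {E : Type*} [NormedAddCommGroup E] [InnerProductSpace ℝ E] [FiniteDimensional ℝ E]

lemma fourier_gaussian [MeasurableSpace E] [BorelSpace E] {τ : ℂ} (hτ : 0 < τ.im) (w : E) :
    𝓕 (gaussian E τ : E → ℂ) w = thetaFactor (finrank ℝ E) τ * gaussian E (-1 / τ) w := by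
  have hτ0 := ne_zero_of_im_pos hτ
  have hre : 0 < (-(Real.pi * I * τ)).re := by simpa using mul_pos Real.pi_pos hτ
  have hpi : (Real.pi : ℂ) ≠ 0 := mod_cast Real.pi_ne_zero
  have hgauss : (gaussian E τ : E → ℂ) = fun v ↦ cexp (-(-(Real.pi * I * τ)) * ‖v‖ ^ 2) := by
    ext v
    simp [gaussian]
  rw [hgauss, fourier_gaussian_innerProductSpace hre, thetaFactor]
  congr 2
  · field_simp
    linear_combination -I_sq
  · push_cast
    field_simp
    linear_combination (‖w‖ : ℂ) ^ 2 * I_sq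

lemma discreteTopology_dualLattice (Λ : Submodule ℤ E) [DiscreteTopology Λ] [IsZLattice ℝ Λ] :
    DiscreteTopology (dualLattice Λ) := by
  classical
  let b := (Free.chooseBasis ℤ Λ).ofZLatticeBasis ℝ Λ
  have hspan : dualLattice Λ = Submodule.span ℤ (Set.range
      (LinearMap.BilinForm.dualBasis (innerₗ E) (innerₗ_nondegenerate E) b)) := by
    rw [← LinearMap.BilinForm.dualSubmodule_span_of_basis,
      (Free.chooseBasis ℤ Λ).ofZLatticeBasis_span ℝ]
    rfl
  rw [hspan]
  infer_instance

theorem thetaSeries_one_eq_covolume_inv_mul [MeasurableSpace E] [BorelSpace E]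
    (Λ : Submodule ℤ E) [DiscreteTopology Λ] [IsZLattice ℝ Λ] (z : E) {τ : ℂ} (hτ : 0 < τ.im) :
    thetaSeries Λ 1 z τ = (ZLattice.covolume Λ : ℂ)⁻¹ * (thetaFactor (finrank ℝ E) τ *
      thetaSeries (dualLattice Λ) (fun ξ ↦ cexp (2 * Real.pi * I * ⟪(ξ : E), z⟫)) 0 (-1 / τ)) := by
  have := discreteTopology_dualLattice Λ
  have hsum : Summable fun ξ : dualLattice Λ ↦ 𝓕 (gaussian E τ : E → ℂ) ξ := by
    have h := summable_thetaSeries (U := dualLattice Λ) (c := 1) (by simp) 0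
      (im_neg_one_div_pos hτ)
    simp only [fourier_gaussian hτ]
    simpa [gaussian] using h.mul_left (thetaFactor (finrank ℝ E) τ)
  rw [thetaSeries_one_eq_tsum_gaussian,
    tsum_zlattice_eq_tsum_fourier Λ (summable_norm_restrict_gaussian Λ hτ) hsum, thetaSeries,
    ← tsum_mul_left (a := thetaFactor _ _)]
  congr 2 with ξ
  rw [fourier_gaussian hτ, add_zero, mul_assoc, mul_comm (cexp _)]
  rfl

end Inversion

section Unimodular

variable {E : Type*} [NormedAddCommGroup E] [InnerProductSpace ℝ E]

/-- A lattice is unimodular if it equals its dual; in finite dimension this already forces it to be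
discrete and of full rank. -/
def IsUnimodular (U : Submodule ℤ E) : Prop := dualLattice U = U

namespace IsUnimodular

variable {U : Submodule ℤ E} (hU : IsUnimodular U)

include hU

lemma mem_iff {v : E} : v ∈ U ↔ ∀ w ∈ U, ∃ k : ℤ, ⟪v, w⟫ = (k : ℝ) := by
  rw [← mem_dualLattice, hU]

lemma integral {v w : E} (hv : v ∈ U) (hw : w ∈ U) : ∃ k : ℤ, ⟪v, w⟫ = (k : ℝ) :=
  hU.mem_iff.1 hv w hw

lemma one_le_norm_sq {v : E} (hv : v ∈ U) (hv0 : v ≠ 0) : 1 ≤ ‖v‖ ^ 2 := by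
  obtain ⟨k, hk⟩ := hU.integral hv hv
  have hpos : 0 < ‖v‖ ^ 2 := by positivity
  rw [← real_inner_self_eq_norm_sq, hk] at hpos ⊢
  exact_mod_cast hpos

lemma discreteTopology : DiscreteTopology U := by
  rw [discreteTopology_iff_isOpen_singleton_zero]
  refine ⟨Metric.ball 0 1, Metric.isOpen_ball, ?_⟩
  ext v
  simp only [Set.mem_preimage, mem_ball_zero_iff, Set.mem_singleton_iff]
  refine ⟨fun hlt ↦ ?_, fun hv ↦ by simp [hv]⟩
  by_contra hv
  nlinarith [norm_nonneg (v : E), hU.one_le_norm_sq v.2 (by simpa using hv)]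

variable [FiniteDimensional ℝ E]

lemma isZLattice [DiscreteTopology U] : IsZLattice ℝ U where
  span_top := by
    rw [← Submodule.orthogonal_eq_bot_iff, Submodule.eq_bot_iff]
    intro x hx
    have horth (v : E) (hv : v ∈ U) : ⟪x, v⟫ = 0 :=
      (Submodule.mem_orthogonal' _ x).1 hx v (Submodule.subset_span hv)
    have hxU : x ∈ U := hU.mem_iff.2 fun v hv ↦ ⟨0, by simp [horth v hv]⟩
    exact inner_self_eq_zero.1 (horth x hxU)

lemma covolume_eq_one [MeasurableSpace E] [BorelSpace E] [DiscreteTopology U] :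
    ZLattice.covolume U = 1 := by
  have := hU.isZLattice
  have hinv := thetaSeries_one_eq_covolume_inv_mul U 0 (τ := I) (by simp)
  have hU' : dualLattice U = U := hU
  have hone : (fun ξ : U ↦ cexp (2 * Real.pi * I * ⟪(ξ : E), (0 : E)⟫)) = 1 := by
    ext ξ
    simp
  rw [hU', thetaFactor_I, one_mul, hone, neg_div, one_div, inv_I, neg_neg] at hinv
  have hcov := (mul_eq_right₀ (thetaSeries_one_I_ne_zero U 0)).1 hinv.symm
  exact_mod_cast inv_eq_one.1 hcov

theorem thetaSeries_one (z : E) {τ : ℂ} (hτ : 0 < τ.im) :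
    thetaSeries U 1 z τ = thetaFactor (finrank ℝ E) τ *
      thetaSeries U (fun v ↦ cexp (2 * Real.pi * I * ⟪(v : E), z⟫)) 0 (-1 / τ) := by
  let : MeasurableSpace E := borel E
  have : BorelSpace E := ⟨rfl⟩
  have := hU.discreteTopology
  have := hU.isZLattice
  have hU' : dualLattice U = U := hU
  rw [thetaSeries_one_eq_covolume_inv_mul U z hτ, hU.covolume_eq_one, hU', ofReal_one, inv_one,
    one_mul]

end IsUnimodular

end Unimodular

/-! ### Characteristic vectors and van der Blij's lemma -/

section CharCovectors

variable {E : Type*} [NormedAddCommGroup E] [InnerProductSpace ℝ E]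

lemma exists_inner_add_sub_inner_self {ξ v w : E}
    (hv : ∃ k : ℤ, ⟪ξ, v⟫ - ⟪v, v⟫ = 2 * (k : ℝ)) (hw : ∃ k : ℤ, ⟪ξ, w⟫ - ⟪w, w⟫ = 2 * (k : ℝ))
    (hvw : ∃ k : ℤ, ⟪v, w⟫ = (k : ℝ)) :
    ∃ k : ℤ, ⟪ξ, v + w⟫ - ⟪v + w, v + w⟫ = 2 * (k : ℝ) := by
  obtain ⟨p, hp⟩ := hv
  obtain ⟨q, hq⟩ := hw
  obtain ⟨r, hr⟩ := hvw
  refine ⟨p + q - r, ?_⟩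
  rw [inner_add_right, real_inner_add_add_self, hr]
  push_cast
  linarith

lemma mem_charCovectors_span {s : Set E}
    (hint : Submodule.span ℤ s ≤ dualLattice (Submodule.span ℤ s)) {ξ : E}
    (hξ : ξ ∈ dualLattice (Submodule.span ℤ s))
    (hs : ∀ v ∈ s, ∃ k : ℤ, ⟪ξ, v⟫ - ⟪v, v⟫ = 2 * (k : ℝ)) :
    ξ ∈ charCovectors (Submodule.span ℤ s) := by
  refine ⟨hξ, fun v hv ↦ ?_⟩
  induction hv using Submodule.span_induction with
  | mem v hv => exact hs v hv
  | zero => exact ⟨0, by simp⟩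
  | add v w hv hw ihv ihw =>
    exact exists_inner_add_sub_inner_self ihv ihw (mem_dualLattice.1 (hint hv) w hw)
  | smul a v hv ih =>
    obtain ⟨p, hp⟩ := ih
    obtain ⟨r, hr⟩ := mem_dualLattice.1 (hint hv) v hv
    obtain ⟨s, hs⟩ := Int.even_mul_pred_self a
    have hs' : (a : ℝ) * (a - 1) = s + s := by exact_mod_cast hs
    refine ⟨a * p - s * r, ?_⟩
    rw [← Int.cast_smul_eq_zsmul ℝ, real_inner_smul_right, real_inner_smul_left,
      real_inner_smul_right]
    push_cast
    linear_combination (a : ℝ) * hp + (-(a : ℝ) * (a - 1)) * hr - (r : ℝ) * hs'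

lemma exists_mem_charCovectors_span {ι : Type*} [Finite ι] (b : Basis ι ℝ E)
    (hint : Submodule.span ℤ (Set.range b) ≤ dualLattice (Submodule.span ℤ (Set.range b))) :
    ∃ ξ, ξ ∈ charCovectors (Submodule.span ℤ (Set.range b)) := by
  classical
  have := Fintype.ofFinite ι
  have hb (i : ι) : b i ∈ Submodule.span ℤ (Set.range b) :=
    Submodule.subset_span (Set.mem_range_self i)
  choose k hk using fun i ↦ mem_dualLattice.1 (hint (hb i)) (b i) (hb i)
  obtain ⟨e, he⟩ := exists_linearEquiv_dualLattice_span b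
  refine ⟨e k, mem_charCovectors_span hint (e k).2 ?_⟩
  rintro _ ⟨i, rfl⟩
  have hi : ⟪(e k : E), b i⟫ = k i := by
    simpa [Basis.equivFun_symm_apply, Pi.single_apply] using he k (Pi.single i 1)
  exact ⟨0, by rw [hi, hk, sub_self, Int.cast_zero, mul_zero]⟩

lemma exists_mem_charCovectors [FiniteDimensional ℝ E] (Λ : Submodule ℤ E) [DiscreteTopology Λ]
    [IsZLattice ℝ Λ] (hint : Λ ≤ dualLattice Λ) : ∃ ξ, ξ ∈ charCovectors Λ := by
  have h := exists_mem_charCovectors_span ((Free.chooseBasis ℤ Λ).ofZLatticeBasis ℝ Λ)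
  rw [(Free.chooseBasis ℤ Λ).ofZLatticeBasis_span ℝ] at h
  exact h hint

lemma add_two_smul_mem_charCovectors {Λ : Submodule ℤ E} {ξ v : E} (hξ : ξ ∈ charCovectors Λ)
    (hv : v ∈ dualLattice Λ) : ξ + (2 : ℝ) • v ∈ charCovectors Λ := by
  refine ⟨add_mem hξ.1 (by rw [two_smul]; exact add_mem hv hv), fun w hw ↦ ?_⟩
  obtain ⟨k, hk⟩ := hξ.2 w hw
  obtain ⟨l, hl⟩ := mem_dualLattice.1 hv w hw
  refine ⟨k + l, ?_⟩
  rw [inner_add_left, real_inner_smul_left, hl]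
  push_cast
  linarith

lemma exists_inner_eq_two_mul_add_one {Λ : Submodule ℤ E} {ξ e : E} (hξ : ξ ∈ charCovectors Λ)
    (he : e ∈ Λ) (hnorm : ‖e‖ = 1) : ∃ k : ℤ, ⟪ξ, e⟫ = 2 * k + 1 := by
  obtain ⟨k, hk⟩ := hξ.2 e he
  rw [real_inner_self_eq_norm_sq, hnorm] at hk
  exact ⟨k, by linarith⟩

end CharCovectors

section StandardLattice

variable {E ι : Type*} [NormedAddCommGroup E] [InnerProductSpace ℝ E] [Fintype ι]

lemma mem_span_orthonormalBasis (e : OrthonormalBasis ι ℝ E) {x : E} :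
    x ∈ Submodule.span ℤ (Set.range e) ↔ ∀ i, ∃ k : ℤ, ⟪e i, x⟫ = (k : ℝ) := by
  have h := e.toBasis.mem_span_iff_repr_mem ℤ x
  rw [OrthonormalBasis.coe_toBasis] at h
  simp [h, OrthonormalBasis.repr_apply_apply, eq_comm]

lemma isUnimodular_span_orthonormalBasis (e : OrthonormalBasis ι ℝ E) :
    IsUnimodular (Submodule.span ℤ (Set.range e)) := by
  ext x
  rw [mem_dualLattice, mem_span_orthonormalBasis]
  refine ⟨fun hx i ↦ ?_, fun hx v hv ↦ ?_⟩
  · obtain ⟨k, hk⟩ := hx (e i) (Submodule.subset_span ⟨i, rfl⟩)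
    exact ⟨k, by rw [real_inner_comm, hk]⟩
  · choose k hk using hx
    choose l hl using (mem_span_orthonormalBasis e).1 hv
    refine ⟨∑ i, k i * l i, ?_⟩
    rw [← e.sum_inner_mul_inner x v]
    push_cast
    exact Finset.sum_congr rfl fun i _ ↦ by rw [real_inner_comm, hk, hl]

lemma sum_mem_charCovectors (e : OrthonormalBasis ι ℝ E) :
    ∑ i, e i ∈ charCovectors (Submodule.span ℤ (Set.range e)) := by
  classical
  have hdual := isUnimodular_span_orthonormalBasis e
  refine mem_charCovectors_span hdual.ge (hdual.ge (Submodule.sum_mem _ fun i _ ↦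
    Submodule.subset_span ⟨i, rfl⟩)) ?_
  rintro _ ⟨i, rfl⟩
  exact ⟨0, by simp [sum_inner, e.inner_eq_ite]⟩

lemma norm_sq_sum_orthonormalBasis (e : OrthonormalBasis ι ℝ E) :
    ‖∑ i, e i‖ ^ 2 = Fintype.card ι := by
  classical
  rw [← real_inner_self_eq_norm_sq, sum_inner]
  simp [inner_sum, e.inner_eq_ite]

lemma card_le_norm_sq_of_odd {e : ι → E} (he : Orthonormal ℝ e) {ξ : E}
    (hξ : ∀ i, ∃ k : ℤ, ⟪ξ, e i⟫ = 2 * k + 1) : (Fintype.card ι : ℝ) ≤ ‖ξ‖ ^ 2 := by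
  refine le_trans ?_ (he.sum_inner_products_le ξ (s := Finset.univ))
  rw [Fintype.card_eq_sum_ones, Nat.cast_sum]
  refine Finset.sum_le_sum fun i _ ↦ ?_
  obtain ⟨k, hk⟩ := hξ i
  rw [real_inner_comm, hk, Real.norm_eq_abs, sq_abs, Nat.cast_one, one_le_sq_iff_one_le_abs]
  exact_mod_cast Int.one_le_abs (by omega : 2 * k + 1 ≠ 0)

end StandardLattice

section ThetaTriple

/-- The transformation behaviour of the theta series `θ₂, θ₃, θ₄` of a unimodular lattice of rank
`m`: translation by one multiplies `θ₂` by `ζ` and exchanges `θ₃` and `θ₄`, while inversion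
exchanges `θ₂` and `θ₄` and fixes `θ₃`, up to the factor of automorphy. -/
structure IsThetaTriple (m : ℕ) (ζ : ℂ) (h₂ h₃ h₄ : ℂ → ℂ) : Prop where
  differentiableOn_two : DifferentiableOn ℂ h₂ {τ | 0 < τ.im}
  differentiableOn_three : DifferentiableOn ℂ h₃ {τ | 0 < τ.im}
  differentiableOn_four : DifferentiableOn ℂ h₄ {τ | 0 < τ.im}
  two_add_one : ∀ τ, h₂ (τ + 1) = ζ * h₂ τ
  three_add_one : ∀ τ, h₃ (τ + 1) = h₄ τ
  four_add_one : ∀ τ, h₄ (τ + 1) = h₃ τ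
  two_inversion : ∀ τ : ℂ, 0 < τ.im → h₂ τ = thetaFactor m τ * h₄ (-1 / τ)
  three_inversion : ∀ τ : ℂ, 0 < τ.im → h₃ τ = thetaFactor m τ * h₃ (-1 / τ)
  four_inversion : ∀ τ : ℂ, 0 < τ.im → h₄ τ = thetaFactor m τ * h₂ (-1 / τ)

namespace IsThetaTriple

variable {m : ℕ} {ζ : ℂ} {h₂ h₃ h₄ g₂ g₃ g₄ : ℂ → ℂ}

lemma sub (hh : IsThetaTriple m ζ h₂ h₃ h₄) (hg : IsThetaTriple m ζ g₂ g₃ g₄) :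
    IsThetaTriple m ζ (h₂ - g₂) (h₃ - g₃) (h₄ - g₄) where
  differentiableOn_two := hh.differentiableOn_two.sub hg.differentiableOn_two
  differentiableOn_three := hh.differentiableOn_three.sub hg.differentiableOn_three
  differentiableOn_four := hh.differentiableOn_four.sub hg.differentiableOn_four
  two_add_one τ := by simp [hh.two_add_one, hg.two_add_one, mul_sub]
  three_add_one τ := by simp [hh.three_add_one, hg.three_add_one]
  four_add_one τ := by simp [hh.four_add_one, hg.four_add_one]
  two_inversion τ hτ := by simp [hh.two_inversion τ hτ, hg.two_inversion τ hτ, mul_sub]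
  three_inversion τ hτ := by
    rw [Pi.sub_apply, Pi.sub_apply, hh.three_inversion τ hτ, hg.three_inversion τ hτ, mul_sub]
  four_inversion τ hτ := by simp [hh.four_inversion τ hτ, hg.four_inversion τ hτ, mul_sub]

-- Moving `i + 1` back to `i` by `-1/τ`, `τ + 1`, `-1/τ`, `τ + 1`, `-1/τ` is the relation
-- `(ST)³ = S²` of the modular group; it expresses `ζ` by factors of automorphy alone.
lemma multiplier_eq (hh : IsThetaTriple m ζ h₂ h₃ h₄) (hI : h₂ I ≠ 0) :
    ζ = thetaFactor m (I + 1) * thetaFactor m (-1 / (I + 1) + 1) := by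
  have hI1 : (I + 1 : ℂ) ≠ 0 := fun h ↦ by simpa using congrArg Complex.im h
  have him : 0 < (I + 1 : ℂ).im := by simp
  have him' : 0 < (-1 / (I + 1) + 1 : ℂ).im := by
    simpa using im_neg_one_div_pos him
  have hback : -1 / (-1 / (I + 1) + 1) + 1 = (-1 / I : ℂ) := by
    rw [show (-1 / (I + 1) + 1 : ℂ) = I / (I + 1) by field_simp; ring]
    field_simp
    ring
  refine mul_right_cancel₀ hI ?_
  calc ζ * h₂ I = thetaFactor m (I + 1) * h₃ (-1 / (I + 1) + 1) := by
        rw [← hh.two_add_one, hh.two_inversion _ him, hh.three_add_one]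
    _ = thetaFactor m (I + 1) * (thetaFactor m (-1 / (I + 1) + 1) * h₄ (-1 / I)) := by
        rw [hh.three_inversion _ him', ← hh.four_add_one, hback]
    _ = thetaFactor m (I + 1) * thetaFactor m (-1 / (I + 1) + 1) * h₂ I := by
        rw [hh.two_inversion I (by simp), thetaFactor_I, one_mul, mul_assoc]

end IsThetaTriple

lemma thetaFactor_mul_thetaFactor_neg_one_div (m : ℕ) {τ : ℂ} (hτ : 0 < τ.im) :
    thetaFactor m τ * thetaFactor m (-1 / τ) = 1 := by
  have hτ0 := ne_zero_of_im_pos hτ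
  have hre : 0 < (I / τ).re := by
    rw [div_re, I_re, I_im, zero_mul, zero_div, zero_add, one_mul]
    exact div_pos hτ (normSq_pos.2 hτ0)
  have hinv : I / (-1 / τ) = (I / τ)⁻¹ := by
    field_simp
    linear_combination -I_sq
  have hne := thetaFactor_ne_zero m hτ0
  rw [thetaFactor] at hne
  rw [thetaFactor, thetaFactor, hinv, inv_cpow, mul_inv_cancel₀ hne]
  exact fun harg ↦ (arg_eq_pi_iff.1 harg).1.not_gt hre

variable {E : Type*} [NormedAddCommGroup E] [InnerProductSpace ℝ E]

/-- The theta series `θ₃` of a lattice. -/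
def theta3 (U : Submodule ℤ E) : ℂ → ℂ := thetaSeries U 1 0

/-- The theta series `θ₂` of a lattice, attached to the coset `U + w / 2`, where `w` is meant to be
a characteristic covector. -/
def theta2 (U : Submodule ℤ E) (w : E) : ℂ → ℂ := thetaSeries U 1 ((1 / 2 : ℝ) • w)

/-- The theta series `θ₄` of a lattice, twisted by the character `v ↦ exp (π i ⟪v, w⟫)`; for a
characteristic covector `w` this is the sign `(-1) ^ (‖v‖ ^ 2)`. -/
def theta4 (U : Submodule ℤ E) (w : E) : ℂ → ℂ :=
  thetaSeries U (fun v ↦ cexp (2 * Real.pi * I * ⟪(v : E), (1 / 2 : ℝ) • w⟫)) 0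

lemma norm_cexp_two_pi_mul_I_mul_inner_le (v z : E) : ‖cexp (2 * Real.pi * I * ⟪v, z⟫)‖ ≤ 1 := by
  rw [show 2 * Real.pi * I * (⟪v, z⟫ : ℂ) = ((2 * Real.pi * ⟪v, z⟫ : ℝ) : ℂ) * I by
    push_cast; ring, norm_exp_ofReal_mul_I]

variable {U : Submodule ℤ E} {w : E}

lemma cexp_inner_half_charCovector (hw : w ∈ charCovectors U) (v : U) :
    cexp (2 * Real.pi * I * ⟪(v : E), (1 / 2 : ℝ) • w⟫) =
      cexp (Real.pi * I * (‖(v : E)‖ ^ 2 : ℝ)) := by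
  obtain ⟨k, hk⟩ := hw.2 v v.2
  rw [Complex.exp_eq_exp_iff_exists_int]
  refine ⟨k, ?_⟩
  rw [← real_inner_self_eq_norm_sq, real_inner_smul_right, real_inner_comm,
    show ⟪w, (v : E)⟫ = ⟪(v : E), (v : E)⟫ + 2 * k by linarith]
  push_cast
  ring

lemma cexp_inner_half_charCovector_mul_self (hw : w ∈ charCovectors U) (v : U) :
    cexp (2 * Real.pi * I * ⟪(v : E), (1 / 2 : ℝ) • w⟫) *
      cexp (Real.pi * I * (‖(v : E)‖ ^ 2 : ℝ)) = 1 := by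
  obtain ⟨l, hl⟩ := mem_dualLattice.1 hw.1 v v.2
  rw [← cexp_inner_half_charCovector hw, ← Complex.exp_add, Complex.exp_eq_one_iff]
  refine ⟨l, ?_⟩
  rw [real_inner_smul_right, real_inner_comm, hl]
  push_cast
  ring

lemma theta3_add_one (hw : w ∈ charCovectors U) (τ : ℂ) : theta3 U (τ + 1) = theta4 U w τ := by
  refine tsum_congr fun v ↦ ?_
  beta_reduce
  rw [cexp_inner_half_charCovector hw, Pi.one_apply, one_mul, ← Complex.exp_add, add_zero]
  congr 1
  ring

lemma theta4_add_one (hw : w ∈ charCovectors U) (τ : ℂ) : theta4 U w (τ + 1) = theta3 U τ := by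
  refine tsum_congr fun v ↦ ?_
  rw [Pi.one_apply, one_mul, add_zero, mul_add, add_mul, Complex.exp_add, mul_left_comm, mul_one,
    cexp_inner_half_charCovector_mul_self hw, mul_one]

lemma exists_norm_add_half_sq_eq (hint : U ≤ dualLattice U) (hw : w ∈ charCovectors U) (v : U) :
    ∃ k : ℤ, ‖(v : E) + (1 / 2 : ℝ) • w‖ ^ 2 = 2 * k + ‖w‖ ^ 2 / 4 := by
  obtain ⟨k, hk⟩ := hw.2 v v.2
  obtain ⟨l, hl⟩ := mem_dualLattice.1 (hint v.2) v v.2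
  refine ⟨k + l, ?_⟩
  rw [norm_add_sq_real, ← real_inner_self_eq_norm_sq, real_inner_smul_right,
    real_inner_comm w (v : E), norm_smul, mul_pow, Real.norm_eq_abs, sq_abs]
  push_cast
  linarith

lemma theta2_add_one (hint : U ≤ dualLattice U) (hw : w ∈ charCovectors U) (τ : ℂ) :
    theta2 U w (τ + 1) = cexp (Real.pi * I * (‖w‖ ^ 2 / 4 : ℝ)) * theta2 U w τ := by
  rw [theta2, thetaSeries, thetaSeries, ← tsum_mul_left]
  refine tsum_congr fun v ↦ ?_
  obtain ⟨k, hk⟩ := exists_norm_add_half_sq_eq hint hw v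
  rw [Pi.one_apply, one_mul, one_mul, mul_add, mul_one, add_mul, Complex.exp_add, mul_comm]
  congr 1
  rw [hk, Complex.exp_eq_exp_iff_exists_int]
  refine ⟨k, ?_⟩
  push_cast
  ring

variable [FiniteDimensional ℝ E]

lemma theta2_inversion (hU : IsUnimodular U) (w : E) {τ : ℂ} (hτ : 0 < τ.im) :
    theta2 U w τ = thetaFactor (finrank ℝ E) τ * theta4 U w (-1 / τ) :=
  hU.thetaSeries_one _ hτ

lemma theta3_inversion (hU : IsUnimodular U) {τ : ℂ} (hτ : 0 < τ.im) :
    theta3 U τ = thetaFactor (finrank ℝ E) τ * theta3 U (-1 / τ) := by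
  rw [theta3, hU.thetaSeries_one 0 hτ]
  congr 2
  funext v
  simp

lemma theta4_inversion (hU : IsUnimodular U) (w : E) {τ : ℂ} (hτ : 0 < τ.im) :
    theta4 U w τ = thetaFactor (finrank ℝ E) τ * theta2 U w (-1 / τ) := by
  have hinv : -1 / (-1 / τ) = τ := by
    have := ne_zero_of_im_pos hτ
    field_simp
  rw [theta2_inversion hU w (im_neg_one_div_pos hτ), ← mul_assoc,
    thetaFactor_mul_thetaFactor_neg_one_div _ hτ, one_mul, hinv]

namespace IsUnimodular

lemma isThetaTriple (hU : IsUnimodular U) (hw : w ∈ charCovectors U) :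
    IsThetaTriple (finrank ℝ E) (cexp (Real.pi * I * (‖w‖ ^ 2 / 4 : ℝ)))
      (theta2 U w) (theta3 U) (theta4 U w) :=
  have := hU.discreteTopology
  { differentiableOn_two := differentiableOn_thetaSeries (by simp) _
    differentiableOn_three := differentiableOn_thetaSeries (by simp) _
    differentiableOn_four :=
      differentiableOn_thetaSeries (fun _ ↦ norm_cexp_two_pi_mul_I_mul_inner_le _ _) _
    two_add_one := theta2_add_one hU.ge hw
    three_add_one := theta3_add_one hw
    four_add_one := theta4_add_one hw
    two_inversion := fun _ ↦ theta2_inversion hU w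
    three_inversion := fun _ ↦ theta3_inversion hU
    four_inversion := fun _ ↦ theta4_inversion hU w }

lemma cexp_norm_sq_charCovector (hU : IsUnimodular U) (hw : w ∈ charCovectors U) :
    cexp (Real.pi * I * (‖w‖ ^ 2 / 4 : ℝ)) =
      thetaFactor (finrank ℝ E) (I + 1) * thetaFactor (finrank ℝ E) (-1 / (I + 1) + 1) := by
  have := hU.discreteTopology
  exact (hU.isThetaTriple hw).multiplier_eq (thetaSeries_one_I_ne_zero U _)

-- Van der Blij's lemma: the multiplier of `θ₂` depends only on the rank, so `‖w‖ ^ 2` may be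
-- compared with the corresponding number for the standard lattice.
theorem norm_sq_charCovector (hU : IsUnimodular U) (hw : w ∈ charCovectors U) :
    ∃ k : ℤ, ‖w‖ ^ 2 - finrank ℝ E = 8 * (k : ℝ) := by
  let e := stdOrthonormalBasis ℝ E
  have hstd := (isUnimodular_span_orthonormalBasis e).cexp_norm_sq_charCovector
    (sum_mem_charCovectors e)
  rw [norm_sq_sum_orthonormalBasis, Fintype.card_fin, ← hU.cexp_norm_sq_charCovector hw,
    eq_comm, Complex.exp_eq_exp_iff_exists_int] at hstd
  obtain ⟨k, hk⟩ := hstd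
  refine ⟨k, ?_⟩
  have hpi : (Real.pi * I : ℂ) ≠ 0 := by simp [Real.pi_ne_zero]
  have hquarter : ((‖w‖ ^ 2 / 4 : ℝ) : ℂ) = ((finrank ℝ E / 4 + 2 * k : ℝ) : ℂ) := by
    refine mul_left_cancel₀ hpi ?_
    rw [hk]
    push_cast
    ring
  linarith [ofReal_injective hquarter]

end IsUnimodular

end ThetaTriple

/-! ### Comparison of theta series -/

section LevelOne

open UpperHalfPlane ModularForm SlashInvariantForm ModularFormClass MatrixGroups OnePoint Filter
  Asymptotics

open scoped Manifold

lemma coe_S_smul (z : ℍ) : ((ModularGroup.S • z : ℍ) : ℂ) = -1 / z := by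
  rw [UpperHalfPlane.modular_S_smul]
  simp [neg_div, inv_neg]

lemma coe_T_smul (z : ℍ) : ((ModularGroup.T • z : ℍ) : ℂ) = z + 1 := by
  rw [UpperHalfPlane.modular_T_smul]
  simp [add_comm]

lemma denom_T_eq_one (z : ℍ) : denom ModularGroup.T z = 1 := by
  rw [ModularGroup.denom_apply]
  simp [ModularGroup.T]

lemma discriminant_S_smul (z : ℍ) :
    discriminant (ModularGroup.S • z) = (z : ℂ) ^ 12 * discriminant z := by
  have h := congrFun discriminant_S_invariant z
  rw [SL_slash_apply, ModularGroup.denom_S, zpow_neg] at h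
  rw [← h, mul_left_comm]
  exact (mul_inv_cancel_right₀ (pow_ne_zero 12 z.ne_zero) _).symm.trans (by rw [mul_assoc]; rfl)

lemma discriminant_T_smul (z : ℍ) : discriminant (ModularGroup.T • z) = discriminant z := by
  have h := congrFun discriminant_T_invariant z
  rwa [SL_slash_apply, denom_T_eq_one, one_zpow, mul_one] at h

/-- The quotient of a function on the upper half plane by a power of the modular discriminant. -/
def divDiscriminant (F : ℂ → ℂ) (k : ℕ) (z : ℍ) : ℂ := F z / discriminant z ^ k

variable {F : ℂ → ℂ}

lemma divDiscriminant_slash {m : ℕ} (hT : ∀ τ : ℂ, 0 < τ.im → F (τ + 1) = F τ)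
    (hS : ∀ τ : ℂ, 0 < τ.im → F (-1 / τ) = τ ^ (12 * m) * F τ) (γ : SL(2, ℤ)) :
    divDiscriminant F (m + 1) ∣[(-12 : ℤ)] γ = divDiscriminant F (m + 1) := by
  refine slash_action_generators_SL2Z ?_ ?_ γ
  · ext z
    have hz := z.ne_zero
    have hΔ := discriminant_ne_zero z
    rw [SL_slash_apply, ModularGroup.denom_S, divDiscriminant, divDiscriminant, coe_S_smul,
      hS z z.2, discriminant_S_smul, neg_neg, show (z : ℂ) ^ (12 : ℤ) = (z : ℂ) ^ 12 from rfl]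
    field_simp
    ring
  · ext z
    rw [SL_slash_apply, denom_T_eq_one, one_zpow, mul_one, divDiscriminant, divDiscriminant,
      coe_T_smul, hT z z.2, discriminant_T_smul]

lemma mdifferentiable_divDiscriminant (hF : DifferentiableOn ℂ F {τ | 0 < τ.im}) (k : ℕ) :
    MDiff (divDiscriminant F k) := by
  have hΔ : MDiff (discriminant : ℍ → ℂ) := CuspForm.discriminant.holo'
  refine MDifferentiable.div ?_ (hΔ.pow k) fun z ↦ pow_ne_zero _ (discriminant_ne_zero z)
  rw [UpperHalfPlane.mdifferentiable_iff]
  exact hF.congr fun z hz ↦ by simp [ofComplex_apply_of_im_pos hz]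

lemma isBoundedAtImInfty_divDiscriminant {k : ℕ} (hF : DecaysAtRate (2 * k) F) :
    IsBoundedAtImInfty (divDiscriminant F k) := by
  obtain ⟨C, -, hC⟩ := hF
  have hdecay : (fun z : ℍ ↦ F z) =O[atImInfty]
      fun z : ℍ ↦ Real.exp (-2 * Real.pi * z.im) ^ k := by
    refine IsBigO.of_bound C ?_
    have him : ∀ᶠ z : ℍ in atImInfty, 1 ≤ z.im := (atImInfty_mem _).2 ⟨1, fun z hz ↦ hz⟩
    filter_upwards [him] with z hz
    refine (hC z hz).trans_eq ?_
    rw [Real.norm_of_nonneg (by positivity), ← Real.exp_nat_mul]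
    congr 2
    rw [coe_im]
    ring
  have hquot := hdecay.trans (exp_isBigO_discriminant.pow k)
  exact (div_isBoundedUnder_of_isBigO hquot).isBigO_one ℝ

-- Dividing by a power of the discriminant leaves a modular form of weight `-12`.
theorem eqOn_zero_of_levelOne_of_decaysAtRate {m : ℕ}
    (hF : DifferentiableOn ℂ F {τ | 0 < τ.im})
    (hT : ∀ τ : ℂ, 0 < τ.im → F (τ + 1) = F τ)
    (hS : ∀ τ : ℂ, 0 < τ.im → F (-1 / τ) = τ ^ (12 * m) * F τ)
    (hdecay : DecaysAtRate (2 * (m + 1 : ℕ)) F) : Set.EqOn F 0 {τ | 0 < τ.im} := by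
  have hinv := divDiscriminant_slash hT hS
  let f : ModularForm 𝒮ℒ (-12) :=
    { toFun := divDiscriminant F (m + 1)
      slash_action_eq' := fun _ ⟨γ, hγ⟩ ↦ hγ ▸ hinv γ
      holo' := mdifferentiable_divDiscriminant hF (m + 1)
      bdd_at_cusps' := fun {c} hc ↦ by
        rw [Subgroup.IsArithmetic.isCusp_iff_isCusp_SL2Z] at hc
        rw [isBoundedAt_iff_forall_SL2Z hc]
        intro γ _
        rw [hinv γ]
        exact isBoundedAtImInfty_divDiscriminant hdecay }
  have hf : (f : ℍ → ℂ) = 0 := levelOne_neg_weight_eq_zero (by norm_num) f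
  intro τ hτ
  have hquot : F τ / discriminant ⟨τ, hτ⟩ ^ (m + 1) = 0 := congrFun hf ⟨τ, hτ⟩
  exact (div_eq_zero_iff.1 hquot).resolve_right (pow_ne_zero _ (discriminant_ne_zero _))

end LevelOne

section Comparison

namespace IsThetaTriple

variable {m : ℕ} {ζ : ℂ} {h₂ h₃ h₄ : ℂ → ℂ}

-- `(θ₂ θ₃ θ₄) ^ 8` has level one and weight `12 m`, and vanishes at the cusp to order greater
-- than `m`.
lemma mul_eqOn_zero (hh : IsThetaTriple m ζ h₂ h₃ h₄) (hζ : ζ ^ 8 = 1)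
    (hdecay₂ : DecaysAtRate (m / 4) h₂) (hdecay₃ : DecaysAtRate 1 h₃) :
    Set.EqOn (h₂ * h₃ * h₄) 0 {τ | 0 < τ.im} := by
  have hdecay₄ : DecaysAtRate 1 h₄ := funext hh.three_add_one ▸ hdecay₃.comp_add_one
  have hpow := eqOn_zero_of_levelOne_of_decaysAtRate (F := (h₂ * h₃ * h₄) ^ 8) (m := m)
    (((hh.differentiableOn_two.mul hh.differentiableOn_three).mul hh.differentiableOn_four).pow 8)
    (fun τ _ ↦ by
      simp only [Pi.pow_apply, Pi.mul_apply, hh.two_add_one, hh.three_add_one, hh.four_add_one]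
      linear_combination (h₂ τ * h₃ τ * h₄ τ) ^ 8 * hζ)
    (fun τ hτ ↦ by
      have hfactor : thetaFactor m τ ^ 24 * τ ^ (12 * m) = 1 := by
        have := congrArg (· ^ 3) (thetaFactor_pow_eight m (ne_zero_of_im_pos hτ))
        simp only [one_pow] at this
        rw [← this]
        ring
      simp only [Pi.pow_apply, Pi.mul_apply, hh.two_inversion τ hτ, hh.three_inversion τ hτ,
        hh.four_inversion τ hτ]
      linear_combination (-(h₂ (-1 / τ) * h₃ (-1 / τ) * h₄ (-1 / τ)) ^ 8) * hfactor)
    ((((hdecay₂.mul hdecay₃).mul hdecay₄).pow 8).mono (by push_cast; linarith))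
  exact fun τ hτ ↦ pow_eq_zero_iff (by norm_num) |>.1 (hpow hτ)

theorem three_eqOn_zero (hh : IsThetaTriple m ζ h₂ h₃ h₄) (hζ : ζ ^ 8 = 1)
    (hdecay₂ : DecaysAtRate (m / 4) h₂) (hdecay₃ : DecaysAtRate 1 h₃) :
    Set.EqOn h₃ 0 {τ | 0 < τ.im} := by
  have hopen : IsOpen {τ : ℂ | 0 < τ.im} := isOpen_lt continuous_const continuous_im
  have hconn : IsPreconnected {τ : ℂ | 0 < τ.im} := (convex_halfSpace_im_gt 0).isPreconnected
  have han₂ := hh.differentiableOn_two.analyticOnNhd hopen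
  have han₃ := hh.differentiableOn_three.analyticOnNhd hopen
  have han₄ := hh.differentiableOn_four.analyticOnNhd hopen
  have h₃_of_h₄ (h : ∀ τ ∈ {τ : ℂ | 0 < τ.im}, h₄ τ = 0) : Set.EqOn h₃ 0 {τ | 0 < τ.im} :=
    fun τ hτ ↦ by rw [← hh.four_add_one, h _ (by simpa using hτ), Pi.zero_apply]
  rcases AnalyticOnNhd.eq_zero_or_eq_zero_of_mul_eq_zero (han₂.mul han₃) han₄
    (hh.mul_eqOn_zero hζ hdecay₂ hdecay₃) hconn with h₂₃ | h₄_zero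
  · rcases AnalyticOnNhd.eq_zero_or_eq_zero_of_mul_eq_zero han₂ han₃ h₂₃ hconn with
      h₂_zero | h₃_zero
    · refine h₃_of_h₄ fun τ hτ ↦ ?_
      rw [hh.four_inversion τ hτ, h₂_zero _ (im_neg_one_div_pos hτ), mul_zero]
    · exact h₃_zero
  · exact h₃_of_h₄ h₄_zero

end IsThetaTriple

variable {E : Type*} [NormedAddCommGroup E] [InnerProductSpace ℝ E] [FiniteDimensional ℝ E]
  {U V : Submodule ℤ E}

lemma decaysAtRate_theta3_sub_sum [DiscreteTopology U] (s : Finset U) {μ : ℝ}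
    (hμ : ∀ v : U, v ∉ s → μ ≤ ‖(v : E)‖ ^ 2) :
    DecaysAtRate μ fun τ ↦
      theta3 U τ - ∑ v ∈ s, cexp (Real.pi * I * τ * (‖(v : E)‖ ^ 2 : ℝ)) := by
  classical
  obtain ⟨C, hC, hb⟩ := decaysAtRate_thetaSeries (U := U) (c := fun v ↦ if v ∈ s then 0 else 1)
    (fun v ↦ by split_ifs <;> simp) 0 (μ := μ) (fun v hv ↦ by
      rw [add_zero]
      exact hμ v fun hvs ↦ hv (if_pos hvs))
  refine ⟨C, hC, fun τ hτ ↦ ?_⟩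
  convert hb τ hτ using 2
  have hsum := (summable_thetaSeries (U := U) (c := 1) (by simp) 0 (τ := τ) (by linarith)).hasSum
  have hs : HasSum (fun v : U ↦ if v ∈ s then cexp (Real.pi * I * τ * (‖(v : E)‖ ^ 2 : ℝ)) else 0)
      (∑ v ∈ s, cexp (Real.pi * I * τ * (‖(v : E)‖ ^ 2 : ℝ))) := by
    simpa only [Finset.sum_ite_mem, Finset.inter_self] using
      hasSum_sum_of_ne_finset_zero (L := .unconditional U) fun v hv ↦ if_neg hv
  refine (hsum.sub hs).tsum_eq.symm.trans (tsum_congr fun v ↦ ?_)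
  by_cases hv : v ∈ s <;> simp [hv]

lemma IsUnimodular.decaysAtRate_theta3_sub (hU : IsUnimodular U) (hV : IsUnimodular V) :
    DecaysAtRate 1 (theta3 U - theta3 V) := by
  have hone {W : Submodule ℤ E} (hW : IsUnimodular W) : DecaysAtRate 1 (theta3 W - 1) := by
    have := hW.discreteTopology
    simpa using! decaysAtRate_theta3_sub_sum (U := W) {0} fun v hv ↦
      hW.one_le_norm_sq v.2 (by simpa using hv)
  simpa using (hone hU).sub (hone hV)

lemma decaysAtRate_theta2 [DiscreteTopology U] {w : E} {μ : ℝ} (hint : U ≤ dualLattice U)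
    (hμ : ∀ w ∈ charCovectors U, μ ≤ ‖w‖ ^ 2) (hw : w ∈ charCovectors U) :
    DecaysAtRate (μ / 4) (theta2 U w) := by
  refine decaysAtRate_thetaSeries (by simp) _ fun v _ ↦ ?_
  have hle := hμ _ (add_two_smul_mem_charCovectors hw (hint v.2))
  rw [show w + (2 : ℝ) • (v : E) = (2 : ℝ) • ((v : E) + (1 / 2 : ℝ) • w) by module, norm_smul,
    mul_pow, Real.norm_eq_abs, sq_abs] at hle
  linarith

lemma IsUnimodular.cexp_norm_sq_charCovector_pow_eight (hU : IsUnimodular U) {w : E}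
    (hw : w ∈ charCovectors U) : cexp (Real.pi * I * (‖w‖ ^ 2 / 4 : ℝ)) ^ 8 = 1 := by
  obtain ⟨k, hk⟩ := hU.norm_sq_charCovector hw
  rw [← Complex.exp_nat_mul, Complex.exp_eq_one_iff]
  refine ⟨finrank ℝ E + 8 * k, ?_⟩
  rw [show ‖w‖ ^ 2 = finrank ℝ E + 8 * k by linarith]
  push_cast
  ring

lemma IsUnimodular.exists_mem_charCovectors (hU : IsUnimodular U) :
    ∃ w, w ∈ charCovectors U := by
  have := hU.discreteTopology
  have := hU.isZLattice
  exact _root_.exists_mem_charCovectors U hU.ge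

theorem IsUnimodular.eqOn_theta3 (hU : IsUnimodular U) (hV : IsUnimodular V)
    (hUmin : ∀ w ∈ charCovectors U, (finrank ℝ E : ℝ) ≤ ‖w‖ ^ 2)
    (hVmin : ∀ w ∈ charCovectors V, (finrank ℝ E : ℝ) ≤ ‖w‖ ^ 2) :
    Set.EqOn (theta3 U) (theta3 V) {τ | 0 < τ.im} := by
  have := hU.discreteTopology
  have := hV.discreteTopology
  obtain ⟨w, hw⟩ := hU.exists_mem_charCovectors
  obtain ⟨x, hx⟩ := hV.exists_mem_charCovectors
  have htriple := hV.isThetaTriple hx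
  rw [hV.cexp_norm_sq_charCovector hx, ← hU.cexp_norm_sq_charCovector hw] at htriple
  have hzero := ((hU.isThetaTriple hw).sub htriple).three_eqOn_zero
    (hU.cexp_norm_sq_charCovector_pow_eight hw)
    ((decaysAtRate_theta2 hU.ge hUmin hw).sub (decaysAtRate_theta2 hV.ge hVmin hx))
    (hU.decaysAtRate_theta3_sub hV)
  exact fun τ hτ ↦ sub_eq_zero.1 (hzero hτ)

end Comparison

/-! ### Elkies' theorem -/

section UnitVectors

variable {E : Type*} [NormedAddCommGroup E] [InnerProductSpace ℝ E]

/-- The vectors of norm one in a lattice. -/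
def unitVectors (U : Submodule ℤ E) : Set E := {v | v ∈ U ∧ ‖v‖ = 1}

lemma IsUnimodular.eq_or_eq_neg_or_inner_eq_zero {U : Submodule ℤ E} (hU : IsUnimodular U)
    {v w : E} (hv : v ∈ unitVectors U) (hw : w ∈ unitVectors U) :
    v = w ∨ v = -w ∨ ⟪v, w⟫ = 0 := by
  obtain ⟨k, hk⟩ := hU.integral hv.1 hw.1
  have hle : |⟪v, w⟫| ≤ 1 := by simpa [hv.2, hw.2] using abs_real_inner_le_norm v w
  have hcases : k = 1 ∨ k = -1 ∨ k = 0 := by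
    have : |k| ≤ 1 := by exact_mod_cast hk ▸ hle
    rw [abs_le] at this
    omega
  rcases hcases with rfl | rfl | rfl
  · exact .inl ((inner_eq_one_iff_of_norm_eq_one (𝕜 := ℝ) hv.2 hw.2).1 (by simpa using hk))
  · refine .inr (.inl ((inner_eq_one_iff_of_norm_eq_one (𝕜 := ℝ) hv.2 (by simpa using hw.2)).1 ?_))
    rw [inner_neg_right, hk]
    simp
  · exact .inr (.inr (by simpa using hk))

lemma orthonormal_insert {s : Set E} (hs : Orthonormal ℝ ((↑) : s → E)) {v : E} (hv : ‖v‖ = 1)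
    (horth : ∀ w ∈ s, ⟪v, w⟫ = 0) : Orthonormal ℝ ((↑) : ↥(insert v s) → E) := by
  refine ⟨?_, ?_⟩
  · rintro ⟨x, rfl | hx⟩
    exacts [hv, hs.1 ⟨x, hx⟩]
  · rintro ⟨x, rfl | hx⟩ ⟨y, rfl | hy⟩ hxy
    · exact absurd rfl hxy
    · exact horth y hy
    · exact (real_inner_comm _ _).trans (horth x hx)
    · exact hs.2 (i := ⟨x, hx⟩) (j := ⟨y, hy⟩) fun h ↦ hxy (Subtype.ext (Subtype.mk.inj h))

lemma exists_orthonormal_subset_union_neg {s : Set E} (hfin : s.Finite)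
    (hnorm : ∀ v ∈ s, ‖v‖ = 1)
    (hpair : ∀ v ∈ s, ∀ w ∈ s, v = w ∨ v = -w ∨ ⟪v, w⟫ = 0) :
    ∃ t ⊆ s, Orthonormal ℝ ((↑) : t → E) ∧ s ⊆ t ∪ -t := by
  have hfamily : {t : Set E | t ⊆ s ∧ Orthonormal ℝ ((↑) : t → E)}.Finite :=
    hfin.finite_subsets.subset fun t ht ↦ ht.1
  obtain ⟨t, ⟨hts, ht⟩, hmax⟩ := hfamily.exists_maximal
    ⟨∅, Set.empty_subset s, orthonormal_empty ℝ E⟩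
  refine ⟨t, hts, ht, fun v hv ↦ ?_⟩
  by_contra hvt
  simp only [Set.mem_union, Set.mem_neg, not_or] at hvt
  refine hvt.1 (hmax ⟨Set.insert_subset hv hts, orthonormal_insert ht (hnorm v hv) fun w hw ↦ ?_⟩
    (Set.subset_insert v t) (Set.mem_insert v t))
  rcases hpair v hv w (hts hw) with rfl | rfl | h
  · exact absurd hw hvt.1
  · exact absurd hw (by simpa using hvt.2)
  · exact h

lemma ncard_le_two_mul_ncard {G : Type*} [InvolutiveNeg G] {s t : Set G} (ht : t.Finite)
    (hst : s ⊆ t ∪ -t) : s.ncard ≤ 2 * t.ncard := by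
  rw [← Set.image_neg_eq_neg] at hst
  calc s.ncard ≤ (t ∪ (- ·) '' t).ncard := Set.ncard_le_ncard hst (ht.union (ht.image _))
    _ ≤ t.ncard + ((- ·) '' t).ncard := Set.ncard_union_le _ _
    _ = 2 * t.ncard := by rw [Set.ncard_image_of_injective _ neg_injective, two_mul]

variable [FiniteDimensional ℝ E] {U : Submodule ℤ E}

namespace IsUnimodular

lemma finite_unitVectors (hU : IsUnimodular U) : (unitVectors U).Finite := by
  have := hU.discreteTopology
  have hzero := (summable_exp_neg_mul_norm_sq U one_pos (0 : E)).tendsto_cofinite_zero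
  have hev := hzero.eventually (gt_mem_nhds (Real.exp_pos (-1)))
  rw [Filter.eventually_cofinite] at hev
  refine (hev.image Subtype.val).subset fun v hv ↦ ⟨⟨v, hv.1⟩, ?_, rfl⟩
  simp [hv.2]

lemma two_mul_card_le_ncard_unitVectors (hU : IsUnimodular U) {ι : Type*} [Fintype ι] {e : ι → E}
    (he : Orthonormal ℝ e) (heU : ∀ i, e i ∈ U) :
    2 * Fintype.card ι ≤ (unitVectors U).ncard := by
  have hinj : Function.Injective e := he.linearIndependent.injective
  have hne (i j : ι) : e i ≠ -e j := fun h ↦ by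
    have hi : ⟪e i, -e j⟫ = 1 := by rw [← h, real_inner_self_eq_norm_sq, he.1, one_pow]
    have hj : ⟪e i, -e j⟫ = -⟪e i, e j⟫ := inner_neg_right _ _
    classical
    rw [orthonormal_iff_ite.1 he] at hj
    split_ifs at hj <;> linarith
  have hsub : Set.range (Sum.elim e (Neg.neg ∘ e)) ⊆ unitVectors U := by
    rintro _ ⟨i | i, rfl⟩
    · exact ⟨heU i, he.1 i⟩
    · exact ⟨neg_mem (heU i), by simp [he.1 i]⟩
  have hcard := Set.ncard_le_ncard hsub hU.finite_unitVectors
  rw [← Set.image_univ, Set.ncard_image_of_injective _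
    (hinj.sumElim (neg_injective.comp hinj) hne), Set.ncard_univ, Nat.card_eq_fintype_card,
    Fintype.card_sum] at hcard
  omega

lemma exists_orthonormalBasis_of_le_ncard (hU : IsUnimodular U)
    (hcard : 2 * finrank ℝ E ≤ (unitVectors U).ncard) :
    ∃ e : OrthonormalBasis (Fin (finrank ℝ E)) ℝ E, ∀ i, e i ∈ U := by
  obtain ⟨t, htU, ht, hcover⟩ := exists_orthonormal_subset_union_neg hU.finite_unitVectors
    (fun _ hv ↦ hv.2) fun _ hv _ hw ↦ hU.eq_or_eq_neg_or_inner_eq_zero hv hw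
  have htfin := hU.finite_unitVectors.subset htU
  have : Fintype ↥t := htfin.fintype
  have hle := ncard_le_two_mul_ncard htfin hcover
  rw [← Nat.card_coe_set_eq t, Nat.card_eq_fintype_card] at hle
  have hrank : Fintype.card t ≤ finrank ℝ E := ht.linearIndependent.fintype_card_le_finrank
  have heq : Fintype.card t = finrank ℝ E := by omega
  let e := OrthonormalBasis.mk ht (ht.linearIndependent.span_eq_top_of_card_eq_finrank' heq).ge
  refine ⟨e.reindex (Fintype.equivFinOfCardEq heq), fun i ↦ ?_⟩
  rw [OrthonormalBasis.reindex_apply, OrthonormalBasis.coe_mk]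
  exact (htU (Subtype.prop _)).1

end IsUnimodular

end UnitVectors

section Elkies

lemma eq_zero_of_decaysAtRate {μ ν : ℝ} (hμν : μ < ν) {a : ℂ}
    (ha : DecaysAtRate ν fun τ ↦ a * cexp (Real.pi * I * τ * μ)) : a = 0 := by
  obtain ⟨C, -, hC⟩ := ha
  have hbound : ∀ t : ℝ, 1 ≤ t → ‖a‖ ≤ C * Real.exp (-(Real.pi * (ν - μ) * t)) := fun t ht ↦ by
    have := hC (t * I) (by simpa using ht)
    rw [norm_mul, norm_cexp_pi_mul_I_mul_ofReal, im_ofReal_mul, I_im, mul_one] at this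
    refine le_of_mul_le_mul_right (this.trans_eq ?_)
      (Real.exp_pos (-(Real.pi * t) * μ))
    rw [mul_assoc, ← Real.exp_add]
    ring_nf
  have hlim : Filter.Tendsto (fun t : ℝ ↦ C * Real.exp (-(Real.pi * (ν - μ) * t)))
      Filter.atTop (nhds (C * 0)) :=
    (Real.tendsto_exp_neg_atTop_nhds_zero.comp (Filter.tendsto_id.const_mul_atTop
      (mul_pos Real.pi_pos (sub_pos.2 hμν)))).const_mul C
  rw [mul_zero] at hlim
  exact norm_le_zero_iff.1 (ge_of_tendsto hlim ((Filter.eventually_ge_atTop 1).mono hbound))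

variable {E : Type*} [NormedAddCommGroup E] [InnerProductSpace ℝ E] [FiniteDimensional ℝ E]
  {U V : Submodule ℤ E}

namespace IsUnimodular

omit [FiniteDimensional ℝ E] in
lemma two_le_norm_sq (hU : IsUnimodular U) {v : E} (hv : v ∈ U) (hv0 : v ≠ 0) (hv1 : ‖v‖ ≠ 1) :
    2 ≤ ‖v‖ ^ 2 := by
  obtain ⟨k, hk⟩ := hU.integral hv hv
  have hone := hU.one_le_norm_sq hv hv0
  have hne : ‖v‖ ^ 2 ≠ 1 := fun h ↦ hv1 ((pow_eq_one_iff_of_nonneg (norm_nonneg v) two_ne_zero).1 h)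
  rw [← real_inner_self_eq_norm_sq, hk] at hone hne ⊢
  norm_cast at hone hne ⊢
  omega

lemma decaysAtRate_theta3_sub_ncard (hU : IsUnimodular U) :
    DecaysAtRate 2 fun τ ↦
      theta3 U τ - (1 + (unitVectors U).ncard * cexp (Real.pi * I * τ * (1 : ℝ))) := by
  classical
  have := hU.discreteTopology
  have hfin : {v : U | ‖(v : E)‖ = 1}.Finite :=
    .of_finite_image (hU.finite_unitVectors.subset (by
      rintro _ ⟨v, hv, rfl⟩
      exact ⟨v.2, hv⟩)) Subtype.val_injective.injOn
  have hncard : (unitVectors U).ncard = hfin.toFinset.card := by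
    rw [← Set.ncard_eq_toFinset_card _ hfin, ← Set.ncard_image_of_injective _ Subtype.val_injective]
    congr 1
    ext v
    simp [unitVectors, and_comm]
  have hdecay := decaysAtRate_theta3_sub_sum (U := U) (insert 0 hfin.toFinset) (μ := 2)
    fun v hv ↦ by
      simp only [Finset.mem_insert, Set.Finite.mem_toFinset, Set.mem_ofPred_eq, not_or] at hv
      exact hU.two_le_norm_sq v.2 (by simpa using hv.1) hv.2
  convert hdecay using 3 with τ
  rw [Finset.sum_insert (by simp), Finset.sum_congr rfl fun v hv ↦ by
    rw [show ‖(v : E)‖ = 1 by simpa using hv, one_pow], Finset.sum_const, nsmul_eq_mul, hncard]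
  simp

lemma ncard_unitVectors_eq (hU : IsUnimodular U) (hV : IsUnimodular V)
    (htheta : Set.EqOn (theta3 U) (theta3 V) {τ | 0 < τ.im}) :
    (unitVectors U).ncard = (unitVectors V).ncard := by
  obtain ⟨C, hC, hb⟩ := hV.decaysAtRate_theta3_sub_ncard.sub hU.decaysAtRate_theta3_sub_ncard
  have hzero := eq_zero_of_decaysAtRate (μ := 1) (ν := 2) (by norm_num)
    (a := (unitVectors U).ncard - (unitVectors V).ncard) ⟨C, hC, fun τ hτ ↦ by
      convert hb τ hτ using 2
      rw [Pi.sub_apply, htheta (show 0 < τ.im by linarith)]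
      ring⟩
  exact_mod_cast sub_eq_zero.1 hzero

-- Elkies: such a lattice has the theta series of the standard lattice, hence as many unit vectors.
theorem exists_orthonormalBasis (hU : IsUnimodular U)
    (hmin : ∀ w ∈ charCovectors U, (finrank ℝ E : ℝ) ≤ ‖w‖ ^ 2) :
    ∃ e : OrthonormalBasis (Fin (finrank ℝ E)) ℝ E, ∀ i, e i ∈ U := by
  let e := stdOrthonormalBasis ℝ E
  have heV (i) : e i ∈ Submodule.span ℤ (Set.range e) := Submodule.subset_span ⟨i, rfl⟩
  have hV := isUnimodular_span_orthonormalBasis e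
  have hVmin : ∀ w ∈ charCovectors (Submodule.span ℤ (Set.range e)),
      (finrank ℝ E : ℝ) ≤ ‖w‖ ^ 2 := fun w hw ↦ by
    simpa using card_le_norm_sq_of_odd e.orthonormal fun i ↦
      exists_inner_eq_two_mul_add_one hw (heV i) (e.norm_eq_one i)
  refine hU.exists_orthonormalBasis_of_le_ncard ?_
  rw [hU.ncard_unitVectors_eq hV (hU.eqOn_theta3 hV hmin hVmin)]
  simpa using hV.two_mul_card_le_ncard_unitVectors e.orthonormal heV

omit [FiniteDimensional ℝ E] in
lemma span_orthonormalBasis_eq (hU : IsUnimodular U) {ι : Type*} [Fintype ι]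
    (e : OrthonormalBasis ι ℝ E) (he : ∀ i, e i ∈ U) :
    Submodule.span ℤ (Set.range e) = U := by
  refine le_antisymm (Submodule.span_le.2 (Set.range_subset_iff.2 he)) fun x hx ↦ ?_
  exact (mem_span_orthonormalBasis e).2 fun i ↦ hU.integral (he i) hx

theorem exists_charCovector_norm_sq_le (hU : IsUnimodular U) :
    ∃ w ∈ charCovectors U, ‖w‖ ^ 2 ≤ finrank ℝ E := by
  by_contra! hcon
  obtain ⟨e, he⟩ := hU.exists_orthonormalBasis fun w hw ↦ (hcon w hw).le
  have hlt := hcon _ (hU.span_orthonormalBasis_eq e he ▸ sum_mem_charCovectors e)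
  rw [norm_sq_sum_orthonormalBasis, Fintype.card_fin] at hlt
  exact lt_irrefl _ hlt

end IsUnimodular

end Elkies

/-! ### Gluing lattices of determinant two -/

section GlueVector

variable {E F : Type*} [NormedAddCommGroup E] [InnerProductSpace ℝ E] [NormedAddCommGroup F]
  [InnerProductSpace ℝ F]

lemma intCast_add_half_ne_intCast (k l : ℤ) : (k : ℝ) + 1 / 2 ≠ l := fun h ↦ by
  have h' : (2 * k + 1 : ℝ) = 2 * l := by linarith
  norm_cast at h'
  omega

lemma inner_withLp_prod (p q : WithLp 2 (E × F)) :
    ⟪p, q⟫ = ⟪p.fst, q.fst⟫ + ⟪p.snd, q.snd⟫ :=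
  WithLp.prod_inner_apply p q

lemma finrank_withLp_prod [FiniteDimensional ℝ E] [FiniteDimensional ℝ F] :
    finrank ℝ (WithLp 2 (E × F)) = finrank ℝ E + finrank ℝ F := by
  rw [(WithLp.linearEquiv 2 ℝ (E × F)).finrank_eq, finrank_prod]

/-- A vector `g` of the dual of the integral lattice `L` that represents the nonzero element of a
discriminant group `L' / L` of order two, and has half-integral square. -/
structure IsGlueVector (L : Submodule ℤ E) (g : E) : Prop where
  le_dual : L ≤ dualLattice L
  mem_dual : g ∈ dualLattice L
  inner_self : ∃ k : ℤ, ⟪g, g⟫ = (k : ℝ) + 1 / 2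
  mem_or_sub_mem : ∀ x ∈ dualLattice L, x ∈ L ∨ x - g ∈ L

namespace IsGlueVector

variable {L : Submodule ℤ E} {g : E}

lemma inner_mem (hg : IsGlueVector L g) {v : E} (hv : v ∈ L) : ∃ k : ℤ, ⟪v, g⟫ = (k : ℝ) := by
  simpa only [real_inner_comm] using mem_dualLattice.1 hg.mem_dual v hv

lemma inner_of_notMem (hg : IsGlueVector L g) {x : E} (hx : x ∈ dualLattice L) (hxL : x ∉ L) :
    ∃ k : ℤ, ⟪x, g⟫ = (k : ℝ) + 1 / 2 := by
  obtain ⟨k, hk⟩ := hg.inner_mem ((hg.mem_or_sub_mem x hx).resolve_left hxL)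
  obtain ⟨l, hl⟩ := hg.inner_self
  refine ⟨k + l, ?_⟩
  rw [inner_sub_left, hl] at hk
  push_cast
  linarith

lemma mem_iff (hg : IsGlueVector L g) {x : E} (hx : x ∈ dualLattice L) :
    x ∈ L ↔ ∃ k : ℤ, ⟪x, g⟫ = (k : ℝ) := by
  refine ⟨hg.inner_mem, fun ⟨k, hk⟩ ↦ ?_⟩
  by_contra hxL
  obtain ⟨l, hl⟩ := hg.inner_of_notMem hx hxL
  exact intCast_add_half_ne_intCast l k (hl ▸ hk)

lemma notMem (hg : IsGlueVector L g) : g ∉ L := fun hgL ↦ by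
  obtain ⟨k, hk⟩ := hg.inner_self
  obtain ⟨l, hl⟩ := hg.inner_mem hgL
  exact intCast_add_half_ne_intCast k l (hk ▸ hl)

lemma two_smul_mem (hg : IsGlueVector L g) {x : E} (hx : x ∈ dualLattice L) :
    (2 : ℝ) • x ∈ L := by
  rw [two_smul, hg.mem_iff (add_mem hx hx), inner_add_left]
  by_cases hxL : x ∈ L
  · obtain ⟨k, hk⟩ := hg.inner_mem hxL
    exact ⟨2 * k, by rw [hk]; push_cast; ring⟩
  · obtain ⟨k, hk⟩ := hg.inner_of_notMem hx hxL
    exact ⟨2 * k + 1, by rw [hk]; push_cast; ring⟩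

lemma inner_of_notMem_of_notMem (hg : IsGlueVector L g) {x y : E} (hx : x ∈ dualLattice L)
    (hxL : x ∉ L) (hy : y ∈ dualLattice L) (hyL : y ∉ L) :
    ∃ k : ℤ, ⟪x, y⟫ = (k : ℝ) + 1 / 2 := by
  obtain ⟨k, hk⟩ := hg.inner_of_notMem hx hxL
  obtain ⟨l, hl⟩ := mem_dualLattice.1 hx _ ((hg.mem_or_sub_mem y hy).resolve_left hyL)
  refine ⟨k + l, ?_⟩
  rw [inner_sub_right, hk] at hl
  push_cast
  linarith

lemma inner_charCovector (hg : IsGlueVector L g) {ξ : E} (hξ : ξ ∈ charCovectors L) :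
    ∃ k : ℤ, ⟪ξ, g⟫ = (k : ℝ) := by
  obtain ⟨k, hk⟩ := hξ.2 _ (hg.two_smul_mem hg.mem_dual)
  obtain ⟨l, hl⟩ := hg.inner_self
  refine ⟨k + 2 * l + 1, ?_⟩
  rw [real_inner_smul_right, real_inner_smul_left, real_inner_smul_right, hl] at hk
  push_cast
  linarith

end IsGlueVector

/-- The overlattice of `L ⊕ M` obtained by adjoining the vector `(g, h)`, encoded as the set of
vectors of the dual of `L ⊕ M` that pair integrally with `(g, h)`. -/
def glueLattice (L : Submodule ℤ E) (g : E) (M : Submodule ℤ F) (h : F) :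
    Submodule ℤ (WithLp 2 (E × F)) where
  carrier := {p | p.fst ∈ dualLattice L ∧ p.snd ∈ dualLattice M ∧
    ∃ k : ℤ, ⟪p.fst, g⟫ + ⟪p.snd, h⟫ = (k : ℝ)}
  zero_mem' := ⟨zero_mem _, zero_mem _, 0, by simp⟩
  add_mem' := by
    rintro p q ⟨hpL, hpM, k, hk⟩ ⟨hqL, hqM, l, hl⟩
    refine ⟨add_mem hpL hqL, add_mem hpM hqM, k + l, ?_⟩
    rw [WithLp.add_fst, WithLp.add_snd, inner_add_left, inner_add_left]
    push_cast
    linarith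
  smul_mem' := by
    rintro a p ⟨hpL, hpM, k, hk⟩
    refine ⟨Submodule.smul_mem _ a hpL, Submodule.smul_mem _ a hpM, a * k, ?_⟩
    rw [WithLp.smul_fst, WithLp.smul_snd, ← Int.cast_smul_eq_zsmul ℝ, ← Int.cast_smul_eq_zsmul ℝ,
      real_inner_smul_left, real_inner_smul_left]
    push_cast
    linear_combination (a : ℝ) * hk

variable {L : Submodule ℤ E} {g : E} {M : Submodule ℤ F} {h : F}

lemma toLp_mem_glueLattice (hg : IsGlueVector L g) (hh : IsGlueVector M h) {x : E} {y : F}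
    (hx : x ∈ L) (hy : y ∈ M) : WithLp.toLp 2 (x, y) ∈ glueLattice L g M h := by
  obtain ⟨k, hk⟩ := hg.inner_mem hx
  obtain ⟨l, hl⟩ := hh.inner_mem hy
  exact ⟨hg.le_dual hx, hh.le_dual hy, k + l, by simp [hk, hl]⟩

lemma toLp_glue_mem_glueLattice (hg : IsGlueVector L g) (hh : IsGlueVector M h) :
    WithLp.toLp 2 (g, h) ∈ glueLattice L g M h := by
  obtain ⟨k, hk⟩ := hg.inner_self
  obtain ⟨l, hl⟩ := hh.inner_self
  refine ⟨hg.mem_dual, hh.mem_dual, k + l + 1, ?_⟩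
  rw [WithLp.toLp_fst, WithLp.toLp_snd, hk, hl]
  push_cast
  ring

lemma mem_or_sub_mem_of_mem_glueLattice (hg : IsGlueVector L g) (hh : IsGlueVector M h)
    {p : WithLp 2 (E × F)} (hp : p ∈ glueLattice L g M h) :
    (p.fst ∈ L ∧ p.snd ∈ M) ∨ (p.fst - g ∈ L ∧ p.snd - h ∈ M) := by
  obtain ⟨hpL, hpM, k, hk⟩ := hp
  by_cases hfst : p.fst ∈ L
  · obtain ⟨l, hl⟩ := hg.inner_mem hfst
    refine .inl ⟨hfst, (hh.mem_iff hpM).2 ⟨k - l, ?_⟩⟩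
    push_cast
    linarith
  · obtain ⟨l, hl⟩ := hg.inner_of_notMem hpL hfst
    refine .inr ⟨(hg.mem_or_sub_mem _ hpL).resolve_left hfst,
      (hh.mem_or_sub_mem _ hpM).resolve_left fun hsnd ↦ ?_⟩
    obtain ⟨j, hj⟩ := hh.inner_mem hsnd
    refine intCast_add_half_ne_intCast l (k - j) ?_
    push_cast
    linarith

lemma isUnimodular_glueLattice (hg : IsGlueVector L g) (hh : IsGlueVector M h) :
    IsUnimodular (glueLattice L g M h) := by
  ext q
  rw [mem_dualLattice]
  constructor
  · intro hq
    refine ⟨mem_dualLattice.2 fun v hv ↦ ?_, mem_dualLattice.2 fun v hv ↦ ?_, ?_⟩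
    · simpa [inner_withLp_prod] using hq _ (toLp_mem_glueLattice hg hh hv (zero_mem M))
    · simpa [inner_withLp_prod] using hq _ (toLp_mem_glueLattice hg hh (zero_mem L) hv)
    · exact hq _ (toLp_glue_mem_glueLattice hg hh)
  · rintro ⟨hqL, hqM, k, hk⟩ p hp
    rw [inner_withLp_prod]
    rcases mem_or_sub_mem_of_mem_glueLattice hg hh hp with ⟨hfst, hsnd⟩ | ⟨hfst, hsnd⟩
    · obtain ⟨i, hi⟩ := mem_dualLattice.1 hqL _ hfst
      obtain ⟨j, hj⟩ := mem_dualLattice.1 hqM _ hsnd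
      exact ⟨i + j, by simp [hi, hj]⟩
    · obtain ⟨i, hi⟩ := mem_dualLattice.1 hqL _ hfst
      obtain ⟨j, hj⟩ := mem_dualLattice.1 hqM _ hsnd
      refine ⟨k + i + j, ?_⟩
      rw [inner_sub_right] at hi hj
      push_cast
      linarith

lemma fst_mem_and_snd_mem_charCovectors (hg : IsGlueVector L g) (hh : IsGlueVector M h)
    {w : WithLp 2 (E × F)} (hw : w ∈ charCovectors (glueLattice L g M h)) :
    w.fst ∈ charCovectors L ∧ w.snd ∈ charCovectors M := by
  have hwU : w ∈ glueLattice L g M h := isUnimodular_glueLattice hg hh ▸ hw.1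
  refine ⟨⟨hwU.1, fun v hv ↦ ?_⟩, ⟨hwU.2.1, fun v hv ↦ ?_⟩⟩
  · simpa [inner_withLp_prod] using hw.2 _ (toLp_mem_glueLattice hg hh hv (zero_mem M))
  · simpa [inner_withLp_prod] using hw.2 _ (toLp_mem_glueLattice hg hh (zero_mem L) hv)

lemma toLp_mem_charCovectors (hg : IsGlueVector L g) (hh : IsGlueVector M h) {ξ : E} {η : F}
    (hξ : ξ ∈ charCovectors L) (hη : η ∈ charCovectors M)
    (hglue : ∃ k : ℤ, ⟪ξ, g⟫ + ⟪η, h⟫ - (⟪g, g⟫ + ⟪h, h⟫) = 2 * (k : ℝ)) :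
    WithLp.toLp 2 (ξ, η) ∈ charCovectors (glueLattice L g M h) := by
  have hU := isUnimodular_glueLattice hg hh
  have hsum (p : WithLp 2 (E × F)) (hfst : p.fst ∈ L) (hsnd : p.snd ∈ M) :
      ∃ k : ℤ, ⟪WithLp.toLp 2 (ξ, η), p⟫ - ⟪p, p⟫ = 2 * (k : ℝ) := by
    obtain ⟨i, hi⟩ := hξ.2 _ hfst
    obtain ⟨j, hj⟩ := hη.2 _ hsnd
    refine ⟨i + j, ?_⟩
    rw [inner_withLp_prod, inner_withLp_prod, WithLp.toLp_fst, WithLp.toLp_snd]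
    push_cast
    linarith
  refine ⟨?_, fun p hp ↦ ?_⟩
  · rw [hU]
    obtain ⟨i, hi⟩ := hg.inner_charCovector hξ
    obtain ⟨j, hj⟩ := hh.inner_charCovector hη
    exact ⟨hξ.1, hη.1, i + j, by simp [hi, hj]⟩
  · rcases mem_or_sub_mem_of_mem_glueLattice hg hh hp with ⟨hfst, hsnd⟩ | ⟨hfst, hsnd⟩
    · exact hsum p hfst hsnd
    · have hglue_mem := toLp_glue_mem_glueLattice hg hh
      rw [← sub_add_cancel p (WithLp.toLp 2 (g, h))]
      refine exists_inner_add_sub_inner_self (hsum _ hfst hsnd) ?_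
        (hU.integral (sub_mem hp hglue_mem) hglue_mem)
      simpa only [inner_withLp_prod, WithLp.toLp_fst, WithLp.toLp_snd] using hglue

end GlueVector

section RootLattice

lemma real_inner_eq_mul (x y : ℝ) : ⟪x, y⟫ = x * y := by
  simp [mul_comm]

lemma sqrt_two_mul_self : √2 * √2 = (2 : ℝ) := Real.mul_self_sqrt zero_le_two

lemma mem_latticeA1 {x : ℝ} : x ∈ latticeA1 ↔ ∃ k : ℤ, x = k * √2 := by
  rw [latticeA1, Submodule.mem_span_singleton]
  simp [eq_comm]

lemma mem_dualLattice_latticeA1 {x : ℝ} :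
    x ∈ dualLattice latticeA1 ↔ ∃ k : ℤ, x = k * (√2 / 2) := by
  rw [mem_dualLattice]
  constructor
  · intro hx
    obtain ⟨k, hk⟩ := hx (√2) (mem_latticeA1.2 ⟨1, by simp⟩)
    rw [real_inner_eq_mul] at hk
    exact ⟨k, by linear_combination (√2 / 2) * hk - (x / 2) * sqrt_two_mul_self⟩
  · rintro ⟨k, rfl⟩ v hv
    obtain ⟨l, rfl⟩ := mem_latticeA1.1 hv
    refine ⟨k * l, ?_⟩
    rw [real_inner_eq_mul]
    push_cast
    linear_combination (k * l / 2 : ℝ) * sqrt_two_mul_self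

lemma isGlueVector_latticeA1 : IsGlueVector latticeA1 (√2 / 2) where
  le_dual v hv := by
    obtain ⟨k, rfl⟩ := mem_latticeA1.1 hv
    exact mem_dualLattice_latticeA1.2 ⟨2 * k, by push_cast; ring⟩
  mem_dual := mem_dualLattice_latticeA1.2 ⟨1, by simp⟩
  inner_self := ⟨0, by
    rw [real_inner_eq_mul]
    push_cast
    linear_combination (1 / 4 : ℝ) * sqrt_two_mul_self⟩
  mem_or_sub_mem x hx := by
    obtain ⟨k, rfl⟩ := mem_dualLattice_latticeA1.1 hx
    rcases Int.even_or_odd' k with ⟨l, rfl | rfl⟩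
    · exact .inl (mem_latticeA1.2 ⟨l, by push_cast; ring⟩)
    · exact .inr (mem_latticeA1.2 ⟨l, by push_cast; ring⟩)

lemma intCast_mul_sqrt_two_mem_charCovectors (k : ℤ) : k * √2 ∈ charCovectors latticeA1 := by
  refine ⟨isGlueVector_latticeA1.le_dual (mem_latticeA1.2 ⟨k, rfl⟩), fun v hv ↦ ?_⟩
  obtain ⟨l, rfl⟩ := mem_latticeA1.1 hv
  refine ⟨k * l - l * l, ?_⟩
  rw [real_inner_eq_mul, real_inner_eq_mul]
  push_cast
  linear_combination (k * l - l * l : ℝ) * sqrt_two_mul_self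

end RootLattice

section Discriminant

variable {E : Type*} [NormedAddCommGroup E] [InnerProductSpace ℝ E] {ι : Type*}

lemma dualLattice_dualLattice_span [Finite ι] (b : Basis ι ℝ E) :
    dualLattice (dualLattice (Submodule.span ℤ (Set.range b))) = Submodule.span ℤ (Set.range b) :=
  LinearMap.BilinForm.dualSubmodule_dualSubmodule_of_basis (R := ℤ) (innerₗ E)
    (innerₗ_nondegenerate E) ⟨fun x y ↦ by simp [real_inner_comm]⟩ b

lemma relIndex_span_dualLattice [Fintype ι] [DecidableEq ι] (b : Basis ι ℝ E)
    (hint : Submodule.span ℤ (Set.range b) ≤ dualLattice (Submodule.span ℤ (Set.range b))) :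
    ((Submodule.span ℤ (Set.range b)).toAddSubgroup.relIndex
      (dualLattice (Submodule.span ℤ (Set.range b))).toAddSubgroup : ℝ) =
        |(Matrix.gram ℝ b).det| := by
  obtain ⟨e, he⟩ := exists_linearEquiv_dualLattice_span b
  have hrepr (x : dualLattice (Submodule.span ℤ (Set.range b))) (i : ι) :
      (e.symm x i : ℝ) = ⟪(x : E), b i⟫ := by
    simpa [Pi.single_apply, eq_comm] using he (e.symm x) (Pi.single i 1)
  have hindex := AddSubgroup.relIndex_eq_natAbs_det (Submodule.span ℤ (Set.range b)).toAddSubgroup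
    (dualLattice (Submodule.span ℤ (Set.range b))).toAddSubgroup hint (b.restrictScalars ℤ)
    (Basis.ofEquivFun e.symm)
  rw [hindex, Nat.cast_natAbs, Int.cast_abs, Basis.det_apply, Int.cast_det]
  congr 2
  ext i j
  exact (hrepr _ i).trans ((real_inner_comm _ _).trans
    (congrArg (inner ℝ (b i)) (b.restrictScalars_apply ℤ j)))

lemma exists_isGlueVector_of_relIndex_eq_two {L : Submodule ℤ E} (hint : L ≤ dualLattice L)
    (hdd : dualLattice (dualLattice L) = L)
    (hindex : L.toAddSubgroup.relIndex (dualLattice L).toAddSubgroup = 2) :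
    ∃ g, IsGlueVector L g := by
  obtain ⟨g, hgd, hgL, hcover⟩ := AddSubgroup.relIndex_eq_two_iff_exists_notMem_and.1 hindex
  simp only [Submodule.mem_toAddSubgroup] at hgd hgL hcover
  have htwo : g + g ∈ L := (hcover g hgd).resolve_right hgL
  have hsub (x : E) (hx : x ∈ dualLattice L) : x ∈ L ∨ x - g ∈ L :=
    (hcover x hx).symm.imp_right fun h ↦ by simpa using sub_mem h htwo
  refine ⟨g, hint, hgd, ?_, hsub⟩
  obtain ⟨k, hk⟩ := mem_dualLattice.1 hgd _ htwo
  rw [inner_add_right] at hk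
  rcases Int.even_or_odd' k with ⟨l, rfl | rfl⟩ <;> push_cast at hk
  -- If `⟪g, g⟫` were an integer, `g` would pair integrally with `L' = L ∪ (g + L)`.
  · refine absurd ?_ hgL
    rw [← hdd, mem_dualLattice]
    intro x hx
    rcases hsub x hx with hxL | hxL
    · exact mem_dualLattice.1 hgd x hxL
    · obtain ⟨j, hj⟩ := mem_dualLattice.1 hgd _ hxL
      rw [inner_sub_right] at hj
      exact ⟨j + l, by push_cast; linarith⟩
  · exact ⟨l, by linarith⟩

end Discriminant

section Bimodular

variable {n : ℕ} {L : Submodule ℤ (EuclideanSpace ℝ (Fin n))} {g : EuclideanSpace ℝ (Fin n)}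

namespace IsBimodular

lemma le_dualLattice (hL : IsBimodular L) : L ≤ dualLattice L :=
  fun v hv ↦ mem_dualLattice.2 (hL.integral v hv)

lemma exists_basis (hL : IsBimodular L) :
    ∃ b : Basis (Fin n) ℝ (EuclideanSpace ℝ (Fin n)),
      Submodule.span ℤ (Set.range b) = L ∧ (Matrix.gram ℝ b).det = 2 := by
  obtain ⟨c, hc⟩ := hL.det_eq_two
  have hli : LinearIndependent ℝ fun i ↦ (c i : EuclideanSpace ℝ (Fin n)) :=
    Matrix.linearIndependent_of_det_gram_ne_zero (𝕜 := ℝ) (by rw [hc]; norm_num)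
  refine ⟨Basis.mk hli (hli.span_eq_top_of_card_eq_finrank' (by simp)).ge, ?_, ?_⟩
  · rw [Basis.coe_mk, ← Function.comp_def Subtype.val, Set.range_comp]
    exact (Submodule.map_span L.subtype _).symm.trans (by simp [c.span_eq])
  · rw [Basis.coe_mk, hc]

lemma exists_isGlueVector (hL : IsBimodular L) : ∃ g, IsGlueVector L g := by
  obtain ⟨b, rfl, hb⟩ := hL.exists_basis
  have hindex := relIndex_span_dualLattice b hL.le_dualLattice
  rw [hb, abs_two] at hindex
  exact exists_isGlueVector_of_relIndex_eq_two hL.le_dualLattice (dualLattice_dualLattice_span b)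
    (by exact_mod_cast hindex)

end IsBimodular

end Bimodular

/-! ### The two classes of characteristic covectors -/

section Classes

lemma IsGlueVector.exists_inner_self_add_two_mul_sq {E : Type*} [NormedAddCommGroup E]
    [InnerProductSpace ℝ E] [FiniteDimensional ℝ E] {L : Submodule ℤ E} {g : E}
    (hg : IsGlueVector L g) {ξ : E} (hξ : ξ ∈ charCovectors L) :
    ∃ k m : ℤ, ⟪ξ, ξ⟫ + 2 * (k : ℝ) ^ 2 = finrank ℝ E + 1 + 8 * m := by
  obtain ⟨j, hj⟩ := hg.inner_charCovector hξ
  obtain ⟨k, hk⟩ := hg.inner_self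
  -- `k + 1 - j` is the multiple of `√2` for which the pair has the right parity on the glue vector.
  have hw := toLp_mem_charCovectors hg isGlueVector_latticeA1 hξ
    (intCast_mul_sqrt_two_mem_charCovectors (k + 1 - j)) ⟨0, by
      rw [hj, hk, real_inner_eq_mul, real_inner_eq_mul]
      push_cast
      linear_combination ((k + 1 - j) / 2 - 1 / 4 : ℝ) * sqrt_two_mul_self⟩
  obtain ⟨m, hm⟩ := (isUnimodular_glueLattice hg isGlueVector_latticeA1).norm_sq_charCovector hw
  refine ⟨k + 1 - j, m, ?_⟩
  rw [← real_inner_self_eq_norm_sq, inner_withLp_prod, finrank_withLp_prod, finrank_self,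
    WithLp.toLp_fst, WithLp.toLp_snd, real_inner_eq_mul] at hm
  push_cast at hm ⊢
  linear_combination hm - (k + 1 - j : ℝ) ^ 2 * sqrt_two_mul_self

variable {n : ℕ} {L : Submodule ℤ (EuclideanSpace ℝ (Fin n))} {g : EuclideanSpace ℝ (Fin n)}
  {s : ℤˣ}

lemma IsGlueVector.charCovectors_eq_union (hg : IsGlueVector L g) :
    charCovectors L = charCovectorsSign 1 L ∪ charCovectorsSign (-1) L := by
  refine Set.Subset.antisymm (fun ξ hξ ↦ ?_) (Set.union_subset (fun _ h ↦ h.1) fun _ h ↦ h.1)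
  obtain ⟨k, m, hm⟩ := hg.exists_inner_self_add_two_mul_sq hξ
  rw [finrank_euclideanSpace_fin] at hm
  rcases Int.even_or_odd' k with ⟨l, rfl | rfl⟩
  · refine .inl ⟨hξ, m - l ^ 2, ?_⟩
    push_cast at hm ⊢
    linear_combination hm
  · refine .inr ⟨hξ, m - l ^ 2 - l, ?_⟩
    push_cast at hm ⊢
    linear_combination hm

lemma disjoint_charCovectorsSign (L : Submodule ℤ (EuclideanSpace ℝ (Fin n))) :
    Disjoint (charCovectorsSign 1 L) (charCovectorsSign (-1) L) := by
  refine Set.disjoint_left.2 ?_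
  rintro ξ ⟨-, k, hk⟩ ⟨-, l, hl⟩
  push_cast at hk hl
  have h : (8 * k + 2 : ℝ) = 8 * l := by linarith
  norm_cast at h
  omega

lemma isLeast_defect (hne : (charCovectorsSign s L).Nonempty) :
    IsLeast (defectValues s L) (defect s L) := by
  have hs : (s : ℤ) ≤ 1 := Int.isUnit_iff_abs_eq.1 s.isUnit ▸ le_abs_self _
  let P (k : ℤ) : Prop :=
    ∃ ξ ∈ charCovectorsSign s L, ⟪ξ, ξ⟫ - ((n : ℝ) + ((s : ℤ) : ℝ)) = 8 * (k : ℝ)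
  have hbdd (k : ℤ) (hk : P k) : -((n : ℤ) + s) ≤ 8 * k := by
    obtain ⟨ξ, -, hk⟩ := hk
    have h : -((n : ℝ) + ((s : ℤ) : ℝ)) ≤ 8 * k := by linarith [real_inner_self_nonneg (x := ξ)]
    exact_mod_cast h
  obtain ⟨k, ⟨ξ, hξ, hk⟩, hmin⟩ := Int.exists_least_of_bdd (P := P)
    ⟨-(n + 1), fun k hk ↦ by have := hbdd k hk; omega⟩
    (hne.elim fun ξ hξ ↦ hξ.2.imp fun _ hk ↦ ⟨ξ, hξ, hk⟩)
  have hleast : IsLeast (defectValues s L) ((⟪ξ, ξ⟫ - (n : ℝ)) / 4) := by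
    refine ⟨⟨ξ, hξ, rfl⟩, ?_⟩
    rintro _ ⟨η, hη, rfl⟩
    obtain ⟨l, hl⟩ := hη.2
    have hkl : (k : ℝ) ≤ l := by exact_mod_cast hmin l ⟨η, hη, hl⟩
    simp only
    linarith
  rwa [defect, hleast.csInf_eq]

lemma defect_le {ξ : EuclideanSpace ℝ (Fin n)} (hξ : ξ ∈ charCovectorsSign s L) :
    defect s L ≤ (⟪ξ, ξ⟫ - n) / 4 :=
  (isLeast_defect ⟨ξ, hξ⟩).2 ⟨ξ, hξ, rfl⟩

namespace IsGlueVector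

variable {w : WithLp 2 (EuclideanSpace ℝ (Fin n) × EuclideanSpace ℝ (Fin n))}

lemma snd_mem_charCovectorsSign_neg (hg : IsGlueVector L g)
    (hw : w ∈ charCovectors (glueLattice L g L g)) (hfst : w.fst ∈ charCovectorsSign s L) :
    w.snd ∈ charCovectorsSign (-s) L := by
  obtain ⟨m, hm⟩ := (isUnimodular_glueLattice hg hg).norm_sq_charCovector hw
  obtain ⟨-, k, hk⟩ := hfst
  refine ⟨(fst_mem_and_snd_mem_charCovectors hg hg hw).2, m - k, ?_⟩
  rw [← real_inner_self_eq_norm_sq, inner_withLp_prod, finrank_withLp_prod,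
    finrank_euclideanSpace_fin] at hm
  push_cast at hm ⊢
  linarith

lemma charCovectorsSign_nonempty (hg : IsGlueVector L g) (s : ℤˣ) :
    (charCovectorsSign s L).Nonempty := by
  obtain ⟨w, hw⟩ := (isUnimodular_glueLattice hg hg).exists_mem_charCovectors
  have hfst := (fst_mem_and_snd_mem_charCovectors hg hg hw).1
  rw [hg.charCovectors_eq_union] at hfst
  rcases Int.units_eq_one_or s with rfl | rfl <;> rcases hfst with hfst | hfst
  · exact ⟨_, hfst⟩
  · exact ⟨_, by simpa using hg.snd_mem_charCovectorsSign_neg hw hfst⟩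
  · exact ⟨_, hg.snd_mem_charCovectorsSign_neg hw hfst⟩
  · exact ⟨_, hfst⟩

lemma defect_add_defect_le (hg : IsGlueVector L g)
    (hw : w ∈ charCovectors (glueLattice L g L g)) :
    defect 1 L + defect (-1) L ≤ (‖w‖ ^ 2 - 2 * n) / 4 := by
  have hfst := (fst_mem_and_snd_mem_charCovectors hg hg hw).1
  rw [hg.charCovectors_eq_union] at hfst
  rw [← real_inner_self_eq_norm_sq, inner_withLp_prod]
  rcases hfst with hfst | hfst
  · have hsnd := hg.snd_mem_charCovectorsSign_neg hw hfst
    linarith [defect_le hfst, defect_le hsnd]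
  · have hsnd := hg.snd_mem_charCovectorsSign_neg hw hfst
    rw [neg_neg] at hsnd
    linarith [defect_le hfst, defect_le hsnd]

theorem defect_add_defect_nonpos (hg : IsGlueVector L g) :
    defect 1 L + defect (-1) L ≤ 0 := by
  obtain ⟨w, hw, hle⟩ := (isUnimodular_glueLattice hg hg).exists_charCovector_norm_sq_le
  rw [finrank_withLp_prod, finrank_euclideanSpace_fin] at hle
  push_cast at hle
  linarith [hg.defect_add_defect_le hw]

end IsGlueVector

end Classes

/-! ### The double of a bimodular lattice -/

section Double

variable {E F : Type*} [NormedAddCommGroup E] [InnerProductSpace ℝ E] [NormedAddCommGroup F]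
  [InnerProductSpace ℝ F] {ι : Type*} [Fintype ι] {L : Submodule ℤ E} {g : E}

lemma real_smul_mem_of_eq_intCast {x : E} (hx : x ∈ L) {c : ℝ} (hc : ∃ k : ℤ, c = k) :
    c • x ∈ L := by
  obtain ⟨k, rfl⟩ := hc
  rw [Int.cast_smul_eq_zsmul]
  exact L.smul_mem k hx

lemma notMem_of_inner_self_eq_half (hL : L ≤ dualLattice L) {x : E} (hx : ⟪x, x⟫ = 1 / 2) :
    x ∉ L := fun hxL ↦ by
  obtain ⟨k, hk⟩ := mem_dualLattice.1 (hL hxL) x hxL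
  exact intCast_add_half_ne_intCast 0 k (by rw [← hk, hx, Int.cast_zero, zero_add])

namespace IsGlueVector

lemma fst_of_norm_eq_one (hg : IsGlueVector L g) {p : WithLp 2 (E × E)}
    (hp : p ∈ glueLattice L g L g) (hnorm : ‖p‖ = 1) :
    p.fst ∈ L ∧ p.snd = 0 ∨ p.fst = 0 ∨ ⟪p.fst, p.fst⟫ = 1 / 2 := by
  have hsum : ⟪p.fst, p.fst⟫ + ⟪p.snd, p.snd⟫ = 1 := by
    rw [← inner_withLp_prod, real_inner_self_eq_norm_sq, hnorm, one_pow]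
  have hfst_nonneg : 0 ≤ ⟪p.fst, p.fst⟫ := real_inner_self_nonneg
  have hsnd_nonneg : 0 ≤ ⟪p.snd, p.snd⟫ := real_inner_self_nonneg
  rcases mem_or_sub_mem_of_mem_glueLattice hg hg hp with ⟨hfst, hsnd⟩ | ⟨hfst, hsnd⟩
  · obtain ⟨a, ha⟩ := mem_dualLattice.1 hp.1 _ hfst
    obtain ⟨b, hb⟩ := mem_dualLattice.1 hp.2.1 _ hsnd
    rw [ha] at hsum hfst_nonneg
    rw [hb] at hsum hsnd_nonneg
    norm_cast at hsum hfst_nonneg hsnd_nonneg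
    obtain rfl | rfl : a = 0 ∨ b = 0 := by omega
    · exact .inr (.inl (inner_self_eq_zero.1 (ha.trans Int.cast_zero)))
    · exact .inl ⟨hfst, inner_self_eq_zero.1 (hb.trans Int.cast_zero)⟩
  · have notMem_of_sub_mem {x : E} (hx : x - g ∈ L) : x ∉ L := fun hxL ↦
      hg.notMem (by simpa using sub_mem hxL hx)
    obtain ⟨a, ha⟩ := hg.inner_of_notMem_of_notMem hp.1 (notMem_of_sub_mem hfst) hp.1
      (notMem_of_sub_mem hfst)
    obtain ⟨b, hb⟩ := hg.inner_of_notMem_of_notMem hp.2.1 (notMem_of_sub_mem hsnd) hp.2.1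
      (notMem_of_sub_mem hsnd)
    have ha_gt : (-1 : ℝ) < a := by linarith
    have hb_gt : (-1 : ℝ) < b := by linarith
    have hab : (a : ℝ) + b = 0 := by linarith
    norm_cast at ha_gt hb_gt hab
    obtain rfl : a = 0 := by omega
    exact .inr (.inr (by rw [ha, Int.cast_zero, zero_add]))

lemma eq_or_eq_neg (hg : IsGlueVector L g) {x y : E} (hx : x ∈ dualLattice L)
    (hx_half : ⟪x, x⟫ = 1 / 2) (hy : y ∈ dualLattice L) (hy_half : ⟪y, y⟫ = 1 / 2) :
    y = x ∨ y = -x := by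
  obtain ⟨k, hk⟩ := hg.inner_of_notMem_of_notMem hy
    (notMem_of_inner_self_eq_half hg.le_dual hy_half) hx
    (notMem_of_inner_self_eq_half hg.le_dual hx_half)
  have hsub : ⟪y - x, y - x⟫ = -2 * k := by
    rw [real_inner_sub_sub_self, hx_half, hy_half, hk]
    ring
  have hadd : ⟪y + x, y + x⟫ = 2 * k + 2 := by
    rw [real_inner_add_add_self, hx_half, hy_half, hk]
    ring
  have hk_le : (k : ℝ) ≤ 0 := by linarith [real_inner_self_nonneg (x := y - x)]
  have hk_ge : (-1 : ℝ) ≤ k := by linarith [real_inner_self_nonneg (x := y + x)]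
  norm_cast at hk_le hk_ge
  obtain rfl | rfl : k = 0 ∨ k = -1 := by omega
  · exact .inl (sub_eq_zero.1 (inner_self_eq_zero.1 (hsub.trans (by simp))))
  · exact .inr (eq_neg_of_add_eq_zero_left (inner_self_eq_zero.1 (hadd.trans (by simp))))

end IsGlueVector

lemma sum_inner_fst_smul_fst (e : OrthonormalBasis ι ℝ (WithLp 2 (E × F))) (v : E) :
    ∑ i, ⟪(e i).fst, v⟫ • (e i).fst = v := by
  have h := congrArg (fun p : WithLp 2 (E × F) ↦ (WithLp.linearEquiv 2 ℝ (E × F) p).1)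
    (e.sum_repr' (WithLp.toLp 2 (v, 0)))
  simpa [WithLp.prod_inner_apply, Prod.fst_sum] using h

lemma inner_fst_fst_of_snd_eq_zero [DecidableEq ι]
    (e : OrthonormalBasis ι ℝ (WithLp 2 (E × F))) {i : ι} (hi : (e i).snd = 0) (j : ι) :
    ⟪(e i).fst, (e j).fst⟫ = if i = j then 1 else 0 := by
  rw [← e.inner_eq_ite, inner_withLp_prod, hi, inner_zero_left, add_zero]

/-- The vectors of an orthonormal basis of `E × F` that lie in `E`, together with `√2` times the
`E`-component of a further basis vector `e j`. -/
def fstFamily (e : OrthonormalBasis ι ℝ (WithLp 2 (E × F))) (j : ι) :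
    {i // (e i).snd = 0} ⊕ Unit → E :=
  Sum.elim (fun i ↦ (e i).fst) fun _ ↦ √2 • (e j).fst

lemma orthonormal_fstFamily (e : OrthonormalBasis ι ℝ (WithLp 2 (E × F))) {j : ι}
    (hj : ⟪(e j).fst, (e j).fst⟫ = 1 / 2) : Orthonormal ℝ (fstFamily e j) := by
  classical
  have hne {i : ι} (hi : (e i).snd = 0) : i ≠ j := by
    rintro rfl
    rw [inner_fst_fst_of_snd_eq_zero e hi, if_pos rfl] at hj
    norm_num at hj
  have horth (i : {i // (e i).snd = 0}) : ⟪(e i).fst, √2 • (e j).fst⟫ = 0 := by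
    rw [real_inner_smul_right, inner_fst_fst_of_snd_eq_zero e i.2, if_neg (hne i.2), mul_zero]
  rw [orthonormal_iff_ite]
  rintro (i | _) (i' | _)
  · simp [fstFamily, inner_fst_fst_of_snd_eq_zero e i.2, Subtype.coe_inj]
  · simpa [fstFamily] using horth i
  · simpa [fstFamily, real_inner_comm] using horth i'
  · rw [if_pos rfl]
    change ⟪√2 • (e j).fst, √2 • (e j).fst⟫ = 1
    rw [real_inner_smul_left, real_inner_smul_right, hj]
    linear_combination (1 / 2 : ℝ) * sqrt_two_mul_self

/-- An orthonormal basis of the ambient space for which `L` is the lattice of vectors with integral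
coordinates, except that the last coordinate runs through `ℤ√2`. -/
def IsDiagonalBasis (L : Submodule ℤ E) {κ : Type*} [Fintype κ]
    (b : OrthonormalBasis (κ ⊕ Unit) ℝ E) : Prop :=
  ∀ v, v ∈ L ↔ (∀ i, ∃ k : ℤ, ⟪b (.inl i), v⟫ = k) ∧ ⟪b (.inr ()), v⟫ ∈ latticeA1

lemma isDiagonalBasis_of_mem (hL : L ≤ dualLattice L) {κ : Type*} [Fintype κ]
    {b : OrthonormalBasis (κ ⊕ Unit) ℝ E} (hinl : ∀ i, b (.inl i) ∈ L)
    (hinr : √2 • b (.inr ()) ∈ L) (hcoord : ∀ v ∈ L, ⟪b (.inr ()), v⟫ ∈ latticeA1) :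
    IsDiagonalBasis L b := by
  refine fun v ↦ ⟨fun hv ↦ ⟨fun i ↦ mem_dualLattice.1 (hL (hinl i)) v hv, hcoord v hv⟩, ?_⟩
  rintro ⟨hint, hlast⟩
  obtain ⟨k, hk⟩ := mem_latticeA1.1 hlast
  rw [← b.sum_repr' v, Fintype.sum_sum_type, Fintype.sum_unique (ι := Unit)]
  refine add_mem (sum_mem fun i _ ↦ real_smul_mem_of_eq_intCast (hinl i) (hint i)) ?_
  change ⟪b (.inr ()), v⟫ • b (.inr ()) ∈ L
  rw [hk, mul_smul]
  exact real_smul_mem_of_eq_intCast hinr ⟨k, rfl⟩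

namespace IsGlueVector

variable {e : OrthonormalBasis ι ℝ (WithLp 2 (E × E))} {j : ι}

lemma exists_inner_self_fst_eq_half (hg : IsGlueVector L g)
    (he : ∀ i, e i ∈ glueLattice L g L g) : ∃ j, ⟪(e j).fst, (e j).fst⟫ = 1 / 2 := by
  by_contra! hne
  refine hg.notMem ?_
  rw [← sum_inner_fst_smul_fst e g]
  refine sum_mem fun i _ ↦ ?_
  rcases hg.fst_of_norm_eq_one (he i) (e.norm_eq_one i) with ⟨hi, -⟩ | hi | hi
  · exact real_smul_mem_of_eq_intCast hi (hg.inner_mem hi)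
  · rw [hi, smul_zero]
    exact zero_mem L
  · exact absurd hi (hne i)

lemma fst_mem_of_snd_eq_zero (hg : IsGlueVector L g) (he : ∀ i, e i ∈ glueLattice L g L g) {i : ι}
    (hi : (e i).snd = 0) : (e i).fst ∈ L := by
  classical
  have hself := inner_fst_fst_of_snd_eq_zero e hi i
  rw [if_pos rfl] at hself
  rcases hg.fst_of_norm_eq_one (he i) (e.norm_eq_one i) with ⟨h, -⟩ | h | h
  · exact h
  · rw [h, inner_zero_left] at hself
    exact absurd hself zero_ne_one
  · rw [hself] at h
    norm_num at h

lemma span_fstFamily (hg : IsGlueVector L g) (he : ∀ i, e i ∈ glueLattice L g L g)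
    (hj : ⟪(e j).fst, (e j).fst⟫ = 1 / 2) : ⊤ ≤ Submodule.span ℝ (Set.range (fstFamily e j)) := by
  have hfst : (e j).fst ∈ Submodule.span ℝ (Set.range (fstFamily e j)) :=
    (Submodule.smul_mem_iff _ (by positivity : √2 ≠ 0)).1 (Submodule.subset_span ⟨.inr (), rfl⟩)
  intro v _
  rw [← sum_inner_fst_smul_fst e v]
  refine sum_mem fun i _ ↦ Submodule.smul_mem _ _ ?_
  rcases hg.fst_of_norm_eq_one (he i) (e.norm_eq_one i) with ⟨-, hi⟩ | hi | hi
  · exact Submodule.subset_span ⟨.inl ⟨i, hi⟩, rfl⟩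
  · rw [hi]
    exact zero_mem _
  · rcases hg.eq_or_eq_neg (he j).1 hj (he i).1 hi with h | h <;> rw [h]
    exacts [hfst, neg_mem hfst]

lemma isDiagonalBasis_mk_fstFamily [Fintype {i // (e i).snd = 0}] (hg : IsGlueVector L g)
    (he : ∀ i, e i ∈ glueLattice L g L g) (hj : ⟪(e j).fst, (e j).fst⟫ = 1 / 2) :
    IsDiagonalBasis L
      (OrthonormalBasis.mk (orthonormal_fstFamily e hj) (hg.span_fstFamily he hj)) := by
  refine isDiagonalBasis_of_mem hg.le_dual (fun i ↦ ?_) ?_ fun v hv ↦ ?_ <;>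
    rw [OrthonormalBasis.coe_mk]
  · exact hg.fst_mem_of_snd_eq_zero he i.2
  · change √2 • √2 • (e j).fst ∈ L
    rw [smul_smul, sqrt_two_mul_self]
    exact hg.two_smul_mem (he j).1
  · change ⟪√2 • (e j).fst, v⟫ ∈ latticeA1
    obtain ⟨k, hk⟩ := mem_dualLattice.1 (he j).1 v hv
    exact mem_latticeA1.2 ⟨k, by rw [real_inner_smul_left, hk, mul_comm]⟩

theorem exists_isDiagonalBasis (hg : IsGlueVector L g) (he : ∀ i, e i ∈ glueLattice L g L g) :
    ∃ (m : ℕ) (b : OrthonormalBasis (Fin m ⊕ Unit) ℝ E), IsDiagonalBasis L b := by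
  classical
  obtain ⟨j, hj⟩ := hg.exists_inner_self_fst_eq_half he
  let σ := Fintype.equivFin {i // (e i).snd = 0}
  refine ⟨_, (OrthonormalBasis.mk (orthonormal_fstFamily e hj) (hg.span_fstFamily he hj)).reindex
    (σ.sumCongr (.refl Unit)), fun v ↦ ?_⟩
  rw [hg.isDiagonalBasis_mk_fstFamily he hj v, σ.symm.forall_congr_left]
  simp

end IsGlueVector

end Double

section DiagonalBasis

variable {E : Type*} [NormedAddCommGroup E] [InnerProductSpace ℝ E] {L : Submodule ℤ E}

namespace IsDiagonalBasis

lemma latticeIsometric {m : ℕ} {b : OrthonormalBasis (Fin m ⊕ Unit) ℝ E}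
    (hb : IsDiagonalBasis L b) : LatticeIsometric L (orthogonalSum (latticeI m) latticeA1) := by
  let c := (EuclideanSpace.basisFun (Fin m) ℝ).prod (OrthonormalBasis.singleton Unit ℝ)
  let φ := b.equiv c (Equiv.refl _)
  have hφ (i : Fin m ⊕ Unit) (v : E) : ⟪c i, φ v⟫ = ⟪b i, v⟫ := by
    rw [← φ.inner_map_map (b i) v]
    congr 1
    simp [φ]
  have hmem (v : E) : φ v ∈ orthogonalSum (latticeI m) latticeA1 ↔ v ∈ L := by
    have hprod : φ v ∈ orthogonalSum (latticeI m) latticeA1 ↔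
        (φ v).fst ∈ latticeI m ∧ (φ v).snd ∈ latticeA1 := by
      rw [orthogonalSum, Submodule.mem_map_equiv]
      rfl
    have hinl (i : Fin m) :
        ⟪EuclideanSpace.basisFun (Fin m) ℝ i, (φ v).fst⟫ = ⟪b (.inl i), v⟫ := by
      simp [← hφ, c]
    have hinr : (φ v).snd = ⟪b (.inr ()), v⟫ := by
      simp [← hφ, c]
    rw [hprod, hb v, latticeI, mem_span_orthonormalBasis, hinr]
    simp only [hinl]
  have hmap : L.map (φ.toLinearEquiv.restrictScalars ℤ).toLinearMap =
      orthogonalSum (latticeI m) latticeA1 := by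
    ext p
    rw [Submodule.mem_map_equiv, ← hmem]
    change φ (φ.symm p) ∈ _ ↔ _
    rw [φ.apply_symm_apply]
  exact ⟨(φ.toLinearEquiv.restrictScalars ℤ).ofSubmodules _ _ hmap,
    fun v w ↦ φ.inner_map_map v w⟩

variable {κ : Type*} [Fintype κ]

lemma inl_mem {b : OrthonormalBasis (κ ⊕ Unit) ℝ E} (hb : IsDiagonalBasis L b) (i : κ) :
    b (.inl i) ∈ L := by
  classical
  refine (hb _).2 ⟨fun i' ↦ ⟨if i' = i then 1 else 0, ?_⟩, ?_⟩ <;> rw [b.inner_eq_ite]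
  · simp
  · simp

lemma card_le_norm_sq {b : OrthonormalBasis (κ ⊕ Unit) ℝ E} (hb : IsDiagonalBasis L b) {ξ : E}
    (hξ : ξ ∈ charCovectors L) : (Fintype.card κ : ℝ) ≤ ‖ξ‖ ^ 2 :=
  card_le_norm_sq_of_odd (b.orthonormal.comp Sum.inl Sum.inl_injective) fun i ↦
    exists_inner_eq_two_mul_add_one hξ (hb.inl_mem i) (b.norm_eq_one _)

end IsDiagonalBasis

variable {n : ℕ} {L : Submodule ℤ (EuclideanSpace ℝ (Fin n))} {g : EuclideanSpace ℝ (Fin n)}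

lemma sign_div_four_le_defect {s : ℤˣ} (hne : (charCovectorsSign s L).Nonempty)
    (hmin : ∀ ξ ∈ charCovectors L, (n : ℝ) - 1 ≤ ‖ξ‖ ^ 2) : ((s : ℤ) : ℝ) / 4 ≤ defect s L := by
  obtain ⟨ξ, ⟨hξ, k, hk⟩, hval⟩ := (isLeast_defect hne).1
  have hs : (s : ℤ) ≤ 1 := Int.isUnit_iff_abs_eq.1 s.isUnit ▸ le_abs_self _
  have hle := hmin ξ hξ
  rw [← real_inner_self_eq_norm_sq] at hle
  have hk_gt : (-1 - (s : ℤ) : ℝ) ≤ 8 * k := by linarith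
  have hk_nonneg : 0 ≤ k := by
    norm_cast at hk_gt
    omega
  have hk_nonneg' : (0 : ℝ) ≤ k := by exact_mod_cast hk_nonneg
  rw [← hval]
  simp only
  linarith

theorem IsGlueVector.exists_isDiagonalBasis_of_defect_add_defect_eq_zero
    (hg : IsGlueVector L g) (hzero : defect 1 L + defect (-1) L = 0) :
    ∃ (m : ℕ) (b : OrthonormalBasis (Fin m ⊕ Unit) ℝ (EuclideanSpace ℝ (Fin n))),
      IsDiagonalBasis L b := by
  obtain ⟨e, he⟩ := (isUnimodular_glueLattice hg hg).exists_orthonormalBasis fun w hw ↦ by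
    rw [finrank_withLp_prod, finrank_euclideanSpace_fin]
    push_cast
    linarith [hg.defect_add_defect_le hw]
  exact hg.exists_isDiagonalBasis he

end DiagonalBasis

end

theorem mainTheorem4 {n : ℕ} (L : Submodule ℤ (EuclideanSpace ℝ (Fin n)))
    (hL : IsBimodular L) :
    -- the characteristic covectors split into the two classes
    charCovectors L = charCovectorsSign 1 L ∪ charCovectorsSign (-1) L ∧
    Disjoint (charCovectorsSign 1 L) (charCovectorsSign (-1) L) ∧
    -- the minima defining the two defects are attained
    IsLeast (defectValues 1 L) (defect 1 L) ∧
    IsLeast (defectValues (-1) L) (defect (-1) L) ∧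
    defect 1 L + defect (-1) L ≤ 0 ∧
    (defect 1 L + defect (-1) L = 0 →
      LatticeIsometric L (orthogonalSum (latticeI (n - 1)) latticeA1) ∧
      defect 1 L = 1 / 4 ∧ defect (-1) L = -1 / 4) := by
  obtain ⟨g, hg⟩ := hL.exists_isGlueVector
  refine ⟨hg.charCovectors_eq_union, disjoint_charCovectorsSign L,
    isLeast_defect (hg.charCovectorsSign_nonempty 1),
    isLeast_defect (hg.charCovectorsSign_nonempty (-1)), hg.defect_add_defect_nonpos,
    fun hzero ↦ ?_⟩
  obtain ⟨m, b, hb⟩ := hg.exists_isDiagonalBasis_of_defect_add_defect_eq_zero hzero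
  obtain rfl : n = m + 1 := by simpa using Module.finrank_eq_card_basis b.toBasis
  have hmin (ξ) (hξ : ξ ∈ charCovectors L) : ((m + 1 : ℕ) : ℝ) - 1 ≤ ‖ξ‖ ^ 2 := by
    simpa using hb.card_le_norm_sq hξ
  have hplus := sign_div_four_le_defect (hg.charCovectorsSign_nonempty 1) hmin
  have hminus := sign_div_four_le_defect (hg.charCovectorsSign_nonempty (-1)) hmin
  push_cast at hplus hminus
  exact ⟨hb.latticeIsometric, by linarith, by linarith⟩
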